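/- Let $\Omega\subset\mathbb R^d$ be a bounded open set, $0<\alpha<1$, $\gamma,\varepsilon,T>0$, and $F(z)=\frac14(z^2-1)^2$. Impose homogeneous Dirichlet, homogeneous Neumann, or (if $\Omega$ is a box) periodic boundary conditions, and let $V$ be the corresponding space $H^1_0(\Omega)$, $H^1(\Omega)$ or $H^1_{\mathrm{per}}(\Omega)$. Write $\langle\cdot,\cdot\rangle$ and $\|\cdot\|$ for the inner product and norm of $L^2(\Omega)$. Let $u$ solve the time-fractional Cahn–Hilliard equation $$\partial_t^\alpha u=\gamma\Delta w,\qquad w=-\varepsilon^2\Delta u+F'(u)\qquad\text{in }(0,T)\times\Omega,$$ with the boundary condition imposed on both $u$ and $w$, where $\partial_t^\alpha u(t)=\frac1{\Gamma(1-\alpha)}\int_0^t\frac{\partial_\tau u(\tau)}{(t-\tau)^\alpha}\,d\tau$ is the Caputo derivative. This means: - $u\in C([0,T];H^1(\Omega)\cap L^6(\Omega))$ with $u(t)\in V$ for $0\le t\le T$; $u$ is differentiable as an $L^2(\Omega)$-valued map on $(0,T)$, with $\partial_tu\in C((0,T);L^2(\Omega))\cap L^1(0,T;L^2(\Omega))$;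 - $w\in C([0,T];L^2(\Omega))$ and $w(t)\in V$ for $0<t<T$; - for all $0<t<T$ and all $\varphi\in V$, $$\langle\partial_t^\alpha u(t),\varphi\rangle=-\gamma\langle\nabla w(t),\nabla\varphi\rangle,\qquad \langle w(t),\varphi\rangle=\varepsilon^2\langle\nabla u(t),\nabla\varphi\rangle+\langle F'(u(t)),\varphi\rangle .$$ For every $t\in[0,T]$ let $\Psi(t)\in V$ be a weak solution of $-\Delta\Psi(t)=u(t)-u(0)$ in $\Omega$ under the same boundary condition, with $\int_\Omega\Psi(t)\,dx=0$ in the Neumann and periodic cases. For $\beta>0$ and $0<t\le T$ put $$D_{\Delta,\beta}(t)=\frac{\|\nabla\Psi(t)\|^2}{2t^\beta}+\frac\beta2\int_0^t\frac{\|\nabla(\Psi(t)-\Psi(\tau))\|^2}{(t-\tau)^{\beta+1}}\,d\tau ,\qquad D_{\Delta,\beta}(0)=0,$$ and assume that $D_{\Delta,\alpha}(t)$ and $D_{\Delta,\alpha+1}(t)$ are well-defined, i.e. that the integrals in them converge, for every $0<t\le T$. Let $$E(t)=\int_\Omega\Big(\frac{\varepsilon^2}2|\nabla u(t)|^2+F(u(t))\Big)dx,\qquad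 \widetilde E(t)=E(t)+\frac1{\gamma\Gamma(1-\alpha)}D_{\Delta,\alpha}(t).$$ Then $$E(t)\le\widetilde E(t)\le\widetilde E(s)\le E(0)\qquad\text{for all }0\le s\le t\le T.$$ -/

import Mathlib

open MeasureTheory Set Filter Topology
open scoped ENNReal ContDiff

noncomputable section

namespace TFCH

/-- `L²(Ω)` for a set `Ω ⊆ ℝᵈ`. -/
abbrev L2 {d : ℕ} (Ω : Set (EuclideanSpace ℝ (Fin d))) : Type :=
  Lp ℝ 2 (volume.restrict Ω)

/-- `L²(Ω; ℝᵈ)`, the space of square integrable vector fields on `Ω`. -/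
abbrev L2Vec {d : ℕ} (Ω : Set (EuclideanSpace ℝ (Fin d))) : Type :=
  Lp (EuclideanSpace ℝ (Fin d)) 2 (volume.restrict Ω)

/-- The three types of boundary conditions. In the periodic case `a` and `b` are the opposite
corners of the periodicity box. -/
inductive BoundaryCondition (d : ℕ) : Type
  | dirichlet : BoundaryCondition d
  | neumann : BoundaryCondition d
  | periodic (a b : Fin d → ℝ) : BoundaryCondition d

/-- The boundary condition makes sense on `Ω`: periodic boundary conditions are posed on the
(nondegenerate) periodicity box, the other two on any domain. -/
def BoundaryCondition.Admissible {d : ℕ} (bc : BoundaryCondition d)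
    (Ω : Set (EuclideanSpace ℝ (Fin d))) : Prop :=
  match bc with
  | .dirichlet => True
  | .neumann => True
  | .periodic a b => (∀ i, a i < b i) ∧ Ω = {x | ∀ i, a i < x i ∧ x i < b i}

/-- `φ ∈ C_c^∞(Ω)`. -/
def IsTestFunction {d : ℕ} (Ω : Set (EuclideanSpace ℝ (Fin d)))
    (φ : EuclideanSpace ℝ (Fin d) → ℝ) : Prop :=
  ContDiff ℝ ∞ φ ∧ HasCompactSupport φ ∧ tsupport φ ⊆ Ω

/-- `φ ∈ C^∞(ℝᵈ)` is periodic with period `bᵢ - aᵢ` in the `i`-th coordinate. -/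
def IsPeriodicTestFunction {d : ℕ} (a b : Fin d → ℝ)
    (φ : EuclideanSpace ℝ (Fin d) → ℝ) : Prop :=
  ContDiff ℝ ∞ φ ∧ ∀ i x, φ (x + EuclideanSpace.single i (b i - a i)) = φ x

/-- Integration by parts against `φ`, without boundary terms: `∫_Ω f ∂_v φ = - ∫_Ω (G · v) φ` for
every direction `v`. -/
def IntegratesByParts {d : ℕ} (Ω : Set (EuclideanSpace ℝ (Fin d))) (f : L2 Ω) (G : L2Vec Ω)
    (φ : EuclideanSpace ℝ (Fin d) → ℝ) : Prop :=
  ∀ v : EuclideanSpace ℝ (Fin d),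
    ∫ x in Ω, f x * fderiv ℝ φ x v = - ∫ x in Ω, inner ℝ (G x) v * φ x

/-- `MemH1 bc Ω f G` says that `f` lies in the energy space of the boundary condition and that `G`
is its weak gradient. The energy space is
* for Dirichlet conditions, `H¹₀(Ω)`, the closure of `C_c^∞(Ω)` in the `H¹` norm;
* for Neumann conditions, `H¹(Ω)`;
* for periodic conditions, `H¹_per(Ω)`, the functions whose periodic extension is locally `H¹`
  (weak derivatives are tested against smooth periodic functions). -/
def MemH1 {d : ℕ} (bc : BoundaryCondition d) (Ω : Set (EuclideanSpace ℝ (Fin d)))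
    (f : L2 Ω) (G : L2Vec Ω) : Prop :=
  match bc with
  | .dirichlet => ∀ η : ℝ≥0∞, 0 < η → ∃ φ, IsTestFunction Ω φ ∧
      eLpNorm (fun x => f x - φ x) 2 (volume.restrict Ω) < η ∧
      eLpNorm (fun x => G x - gradient φ x) 2 (volume.restrict Ω) < η
  | .neumann => ∀ φ, IsTestFunction Ω φ → IntegratesByParts Ω f G φ
  | .periodic a b => ∀ φ, IsPeriodicTestFunction a b φ → IntegratesByParts Ω f G φ

/-- `ψ`, with weak gradient `G`, is a weak solution of `-Δψ = f` in `Ω` under the boundary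
condition `bc`; for Neumann and periodic conditions it is normalized to have zero mean. -/
def IsPotential {d : ℕ} (bc : BoundaryCondition d) (Ω : Set (EuclideanSpace ℝ (Fin d)))
    (f ψ : L2 Ω) (G : L2Vec Ω) : Prop :=
  MemH1 bc Ω ψ G ∧
  (∀ φ Gφ, MemH1 bc Ω φ Gφ → inner ℝ G Gφ = inner ℝ f φ) ∧
  (bc ≠ .dirichlet → ∫ x in Ω, ψ x = 0)

/-- The double well potential `F(z) = (z² - 1)² / 4`. -/
def doubleWell (z : ℝ) : ℝ := (z ^ 2 - 1) ^ 2 / 4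

/-- The Ginzburg–Landau energy `∫_Ω (ε²/2 |∇f|² + F(f))` of a function `f` with weak
gradient `G`. -/
def energy {d : ℕ} (Ω : Set (EuclideanSpace ℝ (Fin d))) (ε : ℝ) (f : L2 Ω) (G : L2Vec Ω) : ℝ :=
  ∫ x in Ω, (ε ^ 2 / 2 * ‖G x‖ ^ 2 + doubleWell (f x))

/-- The Caputo derivative
`∂_t^α u (t) = 1/Γ(1-α) ∫₀ᵗ u'(τ) / (t-τ)^α dτ` of an `L²(Ω)`-valued function. -/
def caputo {d : ℕ} {Ω : Set (EuclideanSpace ℝ (Fin d))} (α : ℝ) (u : ℝ → L2 Ω) (t : ℝ) : L2 Ω :=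
  (Real.Gamma (1 - α))⁻¹ • ∫ τ in Ioo 0 t, ((t - τ) ^ α)⁻¹ • deriv u τ

/-- `u` (with weak gradient `gu`) solves
`∂_t^α u = γ Δ w`, `w = -ε² Δ u + F'(u)` in `(0,T) × Ω`, where `F'(z) = z³ - z`, under the boundary
condition `bc` for both `u` and the chemical potential `w` (with weak gradient `gw`). -/
structure IsSolution {d : ℕ} (bc : BoundaryCondition d) (Ω : Set (EuclideanSpace ℝ (Fin d)))
    (α γ ε T : ℝ) (u : ℝ → L2 Ω) (gu : ℝ → L2Vec Ω) (w : ℝ → L2 Ω) (gw : ℝ → L2Vec Ω) :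
    Prop where
  /-- `u ∈ C([0,T]; H¹)`, with the boundary condition. -/
  memH1 : ∀ t ∈ Icc 0 T, MemH1 bc Ω (u t) (gu t)
  continuousOn : ContinuousOn u (Icc 0 T)
  continuousOn_grad : ContinuousOn gu (Icc 0 T)
  /-- `u ∈ C([0,T]; L⁶)`, that is, `F'(u) ∈ C([0,T]; L²)`. -/
  memL6 : ∀ t ∈ Icc 0 T, MemLp (u t) 6 (volume.restrict Ω)
  continuousOn_L6 : ∀ t ∈ Icc 0 T,
    Tendsto (fun s => eLpNorm (fun x => u s x - u t x) 6 (volume.restrict Ω))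
      (𝓝[Icc 0 T] t) (𝓝 0)
  /-- `∂_t u ∈ C((0,T); L²) ∩ L¹(0,T; L²)`. -/
  differentiableAt : ∀ t ∈ Ioo 0 T, DifferentiableAt ℝ u t
  continuousOn_deriv : ContinuousOn (deriv u) (Ioo 0 T)
  integrableOn_deriv : IntegrableOn (deriv u) (Ioo 0 T)
  /-- `w ∈ C([0,T]; L²)`, and `w(t) ∈ H¹` with the boundary condition for `0 < t < T`. -/
  continuousOn_potential : ContinuousOn w (Icc 0 T)
  memH1_potential : ∀ t ∈ Ioo 0 T, MemH1 bc Ω (w t) (gw t)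
  /-- `∂_t^α u = γ Δ w` weakly. -/
  evolution : ∀ t ∈ Ioo 0 T, ∀ φ Gφ, MemH1 bc Ω φ Gφ →
    inner ℝ (caputo α u t) φ = - γ * inner ℝ (gw t) Gφ
  /-- `w = -ε² Δ u + F'(u)` weakly. -/
  potential : ∀ t ∈ Ioo 0 T, ∀ φ Gφ, MemH1 bc Ω φ Gφ →
    inner ℝ (w t) φ = ε ^ 2 * inner ℝ (gu t) Gφ + ∫ x in Ω, ((u t x) ^ 3 - u t x) * φ x

/-- For a time dependent vector field `g` (the gradient of `Ψ`),
`D_{Δ,β}(t) = ‖g(t)‖² / (2 t^β) + β/2 ∫₀ᵗ ‖g(t) - g(τ)‖² / (t-τ)^(β+1) dτ`. -/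
def nonlocalTerm {d : ℕ} {Ω : Set (EuclideanSpace ℝ (Fin d))} (β : ℝ) (g : ℝ → L2Vec Ω)
    (t : ℝ) : ℝ :=
  ‖g t‖ ^ 2 / (2 * t ^ β) + β / 2 * ∫ τ in Ioo 0 t, ‖g t - g τ‖ ^ 2 / (t - τ) ^ (β + 1)

/-- `D_{Δ,β}(t)` is well-defined: the integral in it converges. -/
def NonlocalTermWellDefined {d : ℕ} {Ω : Set (EuclideanSpace ℝ (Fin d))} (β : ℝ)
    (g : ℝ → L2Vec Ω) (t : ℝ) : Prop :=
  IntegrableOn (fun τ => ‖g t - g τ‖ ^ 2 / (t - τ) ^ (β + 1)) (Ioo 0 t)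

/-- The modified energy `Ẽ(t) = E(t) + D_{Δ,α}(t) / (γ Γ(1-α))`. -/
def modifiedEnergy {d : ℕ} {Ω : Set (EuclideanSpace ℝ (Fin d))} (α γ ε : ℝ)
    (u : ℝ → L2 Ω) (gu : ℝ → L2Vec Ω) (g : ℝ → L2Vec Ω) (t : ℝ) : ℝ :=
  energy Ω ε (u t) (gu t) + 1 / (γ * Real.Gamma (1 - α)) * nonlocalTerm α g t

end TFCH

end

noncomputable section

namespace TFCH

/-! ### Differentiation of convolutions with a smooth kernel -/

section Convolution

variable {F : Type*} [NormedAddCommGroup F] [NormedSpace ℝ F]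

/-! Formally, testing the equation with `(-Δ)⁻¹ ∂ₜu` gives `E' = ⟨w, ∂ₜu⟩ = -γ⁻¹ ⟨∂ₜ^α u, ∂ₜu⟩` with
the last pairing in `H⁻¹`. For a decreasing convex kernel `κ`, the pairing of `y'` with `κ * y'`
dominates the time derivative of the memory term of `y`, so the energy plus a multiple of that term
decreases. Four obstacles are removed separately.

The kernel `t^(-α)` is singular, so it is replaced by `(t + δ)^(-α)`. `hasDerivAt_regMemory`
differentiates the regular memory term exactly, the signs of `κ'` and `κ''` give an inequality, and
`δ → 0` yields `memoryTerm_sub_le`.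

`∂ₜu` is only in `L²` and the potential `Ψ` is not known to be differentiable in time. The `H⁻¹`
product is therefore replaced by `⟨x, (m² - Δ)⁻¹ z⟩`, realized by a bounded map `resolventLift` into
a Hilbert space, along which the regularity of `u` passes to the lifted path. This costs an error
`m² ⟨w, (m² - Δ)⁻¹ ∂ₜu⟩`, which vanishes as `m → 0` (`tendsto_integral_error`), while the lifted
norms converge to `‖∇Ψ‖` (`tendsto_norm_sq_lift`).

The chain rule `E' = ⟨w, ∂ₜu⟩` must hold although `∂ₜu` need not lie in `V`. A trapezoidal estimate
(`abs_energy_sub_le`) writes the increment of `E` as the mean of `w` paired with the increment of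
`u`, up to a quadratically small error.

At time zero the memory term has to be small at least along a sequence. Otherwise it could be
integrated in time against a bound on `⟨y, ∂^α y⟩` that tends to zero
(`le_of_forall_le_memoryTerm`). The final time follows from semicontinuity of the energy. -/

theorem intervalIntegrable_kernel_smul {δ : ℝ} {κ : ℝ → ℝ}
    (hκ : ContinuousOn κ (Ioi (-δ))) {f : ℝ → F} (hf : Continuous f) {x a b : ℝ}
    (ha : a < x + δ) (hb : b < x + δ) :
    IntervalIntegrable (fun τ => κ (x - τ) • f τ) volume a b := by
  refine ContinuousOn.intervalIntegrable
    (ContinuousOn.smul (hκ.comp (by fun_prop) ?_) hf.continuousOn)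
  intro τ hτ
  have := hτ.2
  have h3 : max a b < x + δ := max_lt ha hb
  simp only [mem_Ioi] at *
  linarith

/-- Leibniz rule for a convolution `∫₀ˣ κ(x-τ) f(τ) dτ` with a `C¹` kernel. -/
theorem hasDerivAt_convolution {δ : ℝ} (hδ : 0 < δ) {κ κ' : ℝ → ℝ}
    (hκ : ∀ x ∈ Ioi (-δ), HasDerivAt κ (κ' x) x) (hκ' : ContinuousOn κ' (Ioi (-δ)))
    {f : ℝ → F} [CompleteSpace F] (hf : Continuous f) {t : ℝ} (ht : 0 ≤ t) :
    HasDerivAt (fun x => ∫ τ in (0 : ℝ)..x, κ (x - τ) • f τ)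
      (κ 0 • f t + ∫ τ in (0 : ℝ)..t, κ' (t - τ) • f τ) t := by
  have hκc : ContinuousOn κ (Ioi (-δ)) := fun x hx => (hκ x hx).continuousAt.continuousWithinAt
  -- the part with fixed domain of integration
  have h1 : HasDerivAt (fun x => ∫ τ in (0 : ℝ)..t, κ (x - τ) • f τ)
      (∫ τ in (0 : ℝ)..t, κ' (t - τ) • f τ) t := by
    obtain ⟨C, hC⟩ := (isCompact_Icc (a := -(δ / 2)) (b := t + δ)).exists_bound_of_continuousOn
      (hκ'.mono fun x hx => by simp only [mem_Icc, mem_Ioi] at *; linarith [hx.1])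
    have hs : Metric.ball t (δ / 2) ∈ 𝓝 t := Metric.ball_mem_nhds _ (by linarith)
    have key : ∀ x ∈ Metric.ball t (δ / 2), ∀ τ ∈ uIoc (0 : ℝ) t, x - τ ∈ Icc (-(δ / 2)) (t + δ) := by
      intro x hx τ hτ
      rw [uIoc_of_le ht] at hτ
      rw [Metric.mem_ball, Real.dist_eq, abs_lt] at hx
      constructor <;> linarith [hτ.1, hτ.2, hx.1, hx.2]
    refine (intervalIntegral.hasDerivAt_integral_of_dominated_loc_of_deriv_le
      (F' := fun x τ => κ' (x - τ) • f τ) (bound := fun τ => C * ‖f τ‖) hs ?_ ?_ ?_ ?_ ?_ ?_).2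
    · filter_upwards [hs] with x hx
      rw [Metric.mem_ball, Real.dist_eq, abs_lt] at hx
      exact (intervalIntegrable_kernel_smul hκc hf (by linarith [hx.1])
        (by linarith [hx.1])).def'.aestronglyMeasurable
    · exact intervalIntegrable_kernel_smul hκc hf (by linarith) (by linarith)
    · exact (intervalIntegrable_kernel_smul hκ' hf (by linarith)
        (by linarith)).def'.aestronglyMeasurable
    · refine Eventually.of_forall fun τ hτ x hx => ?_
      rw [norm_smul]
      gcongr
      exact hC _ (key x hx τ hτ)
    · exact Continuous.intervalIntegrable (by fun_prop) _ _
    · refine Eventually.of_forall fun τ hτ x hx => ?_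
      have h := key x hx τ hτ
      have h2 := (hκ (x - τ) (by simp only [mem_Ioi]; linarith [h.1])).comp x
        ((hasDerivAt_id x).sub_const τ)
      simpa using h2.smul_const (f τ)
  -- the part with moving endpoint
  have h2 : HasDerivAt (fun x => ∫ τ in t..x, κ (x - τ) • f τ) (κ 0 • f t) t := by
    rw [hasDerivAt_iff_isLittleO, Asymptotics.isLittleO_iff]
    intro c hc
    have hcont : ContinuousAt (fun p : ℝ × ℝ => κ (p.1 - p.2) • f p.2) (t, t) := by
      refine ContinuousAt.smul (ContinuousAt.comp ?_ (by fun_prop)) (by fun_prop)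
      simpa using (hκ 0 (by simpa using hδ)).continuousAt
    obtain ⟨η, hη, hb⟩ := Metric.continuousAt_iff.1 hcont c hc
    have hs : Metric.ball t (min η δ) ∈ 𝓝 t := Metric.ball_mem_nhds _ (lt_min hη hδ)
    filter_upwards [hs] with x hx
    have hx1 : |x - t| < η := by
      have := lt_of_lt_of_le (Metric.mem_ball.1 hx) (min_le_left _ _); rwa [Real.dist_eq] at this
    have hx2 : |x - t| < δ := by
      have := lt_of_lt_of_le (Metric.mem_ball.1 hx) (min_le_right _ _); rwa [Real.dist_eq] at this
    have hx3 := abs_lt.1 hx2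
    have e : (∫ τ in t..x, κ (x - τ) • f τ) - (∫ τ in t..t, κ (t - τ) • f τ)
        - (x - t) • κ 0 • f t = ∫ τ in t..x, (κ (x - τ) • f τ - κ 0 • f t) := by
      rw [intervalIntegral.integral_sub (intervalIntegrable_kernel_smul hκc hf (by linarith)
        (by linarith)) (by simp)]
      simpa using smul_comm _ _ _
    rw [e]
    have := intervalIntegral.norm_integral_le_of_norm_le_const (a := t) (b := x) (C := c)
      (f := fun τ => κ (x - τ) • f τ - κ 0 • f t) ?_
    · simpa [Real.norm_eq_abs] using this
    intro τ hτ
    have hτ' : |τ - t| ≤ |x - t| := by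
      simpa using abs_sub_left_of_mem_uIcc (uIoc_subset_uIcc hτ)
    have := hb (x := (x, τ)) (by
      rw [Prod.dist_eq]
      exact max_lt (by rwa [Real.dist_eq]) (by rw [Real.dist_eq]; exact lt_of_le_of_lt hτ' hx1))
    simpa [dist_eq_norm] using this.le
  have h3 := h2.add h1
  refine h3.congr_of_eventuallyEq ?_
  filter_upwards [Metric.ball_mem_nhds t hδ] with x hx
  rw [Metric.mem_ball, Real.dist_eq, abs_lt] at hx
  rw [Pi.add_apply, add_comm, intervalIntegral.integral_add_adjacent_intervals] <;>
  exact intervalIntegrable_kernel_smul hκc hf (by linarith) (by linarith)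

end Convolution

/-! ### Caputo convolution and memory term for a smooth kernel -/

section RegularKernel

variable {K : Type*} [NormedAddCommGroup K] [InnerProductSpace ℝ K]

/-- The Caputo type convolution `∫₀ᵗ κ(t-τ) y'(τ) dτ` for `y(0) = 0`, after integration
by parts. -/
def regCaputo (κ κ' : ℝ → ℝ) (y : ℝ → K) (t : ℝ) : K :=
  κ 0 • y t + ∫ τ in (0 : ℝ)..t, κ' (t - τ) • y τ

/-- The memory term with kernel `κ`, with the square expanded. -/
def regMemory (κ κ' : ℝ → ℝ) (y : ℝ → K) (t : ℝ) : ℝ :=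
  κ 0 * ‖y t‖ ^ 2 / 2 + inner ℝ (y t) (∫ τ in (0 : ℝ)..t, κ' (t - τ) • y τ)
    - (∫ τ in (0 : ℝ)..t, κ' (t - τ) • ‖y τ‖ ^ 2) / 2

/-- The subtracted bracket is the time derivative of `∫₀ᵗ κ(t-τ) ‖y τ‖² dτ`, so the time integral of
the memory term is explicit up to boundary values. -/
theorem regMemory_eq_inner_regCaputo (κ κ' : ℝ → ℝ) (y : ℝ → K) (t : ℝ) :
    regMemory κ κ' y t = inner ℝ (y t) (regCaputo κ κ' y t)
      - (κ 0 • ‖y t‖ ^ 2 + ∫ τ in (0 : ℝ)..t, κ' (t - τ) • ‖y τ‖ ^ 2) / 2 := by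
  simp only [regMemory, regCaputo, inner_add_right, inner_smul_right, real_inner_self_eq_norm_sq,
    smul_eq_mul]
  ring

variable {δ : ℝ} {κ κ' κ'' : ℝ → ℝ} {y : ℝ → K}

theorem integral_kernel (hδ : 0 < δ) (hκ : ∀ x ∈ Ioi (-δ), HasDerivAt κ (κ' x) x)
    (hκ' : ContinuousOn κ' (Ioi (-δ))) {t : ℝ} (ht : 0 ≤ t) :
    ∫ τ in (0 : ℝ)..t, κ' (t - τ) = κ t - κ 0 := by
  rw [intervalIntegral.integral_comp_sub_left (fun x => κ' x) t]
  simp only [sub_self, sub_zero]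
  refine intervalIntegral.integral_eq_sub_of_hasDerivAt (fun x hx => hκ x ?_)
    (ContinuousOn.intervalIntegrable (hκ'.mono fun x hx => ?_)) <;>
  · rw [uIcc_of_le ht] at hx
    simp only [mem_Ioi]
    linarith [hx.1]

variable [CompleteSpace K]

theorem integral_kernel_norm_sub_sq (hδ : 0 < δ)
    (hκ : ∀ x ∈ Ioi (-δ), HasDerivAt κ (κ' x) x) (hκ' : ContinuousOn κ' (Ioi (-δ)))
    (hy : Continuous y) {t : ℝ} (ht : 0 ≤ t) :
    ∫ τ in (0 : ℝ)..t, κ' (t - τ) * ‖y t - y τ‖ ^ 2 =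
      (κ t - κ 0) * ‖y t‖ ^ 2 - 2 * inner ℝ (y t) (∫ τ in (0 : ℝ)..t, κ' (t - τ) • y τ)
        + ∫ τ in (0 : ℝ)..t, κ' (t - τ) • ‖y τ‖ ^ 2 := by
  have i1 := intervalIntegrable_kernel_smul (x := t) (a := 0) (b := t) hκ'
    (continuous_const (y := ‖y t‖ ^ 2)) (by linarith) (by linarith)
  have i2 := intervalIntegrable_kernel_smul (x := t) (a := 0) (b := t) hκ' hy
    (by linarith) (by linarith)
  have i3 := intervalIntegrable_kernel_smul (x := t) (a := 0) (b := t) hκ'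
    (f := fun τ => 2 * inner ℝ (y t) (y τ)) (by fun_prop) (by linarith) (by linarith)
  have i4 := intervalIntegrable_kernel_smul (x := t) (a := 0) (b := t) hκ'
    (f := fun τ => ‖y τ‖ ^ 2) (by fun_prop) (by linarith) (by linarith)
  have e : ∀ τ, κ' (t - τ) * ‖y t - y τ‖ ^ 2 = κ' (t - τ) • ‖y t‖ ^ 2
      - κ' (t - τ) • (2 * inner ℝ (y t) (y τ)) + κ' (t - τ) • ‖y τ‖ ^ 2 := by
    intro τ
    rw [norm_sub_sq_real]
    simp only [smul_eq_mul]
    ring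
  simp_rw [e]
  rw [intervalIntegral.integral_add (i1.sub i3) i4, intervalIntegral.integral_sub i1 i3]
  congr 2
  · rw [intervalIntegral.integral_smul_const, integral_kernel hδ hκ hκ' ht, smul_eq_mul]
  · have h := (innerSL ℝ (y t)).intervalIntegral_comp_comm i2
    simp only [innerSL_apply_apply] at h
    rw [← h, ← intervalIntegral.integral_const_mul]
    refine intervalIntegral.integral_congr fun τ _ => ?_
    simp only [smul_eq_mul, inner_smul_right]
    ring

theorem regMemory_eq (hδ : 0 < δ)
    (hκ : ∀ x ∈ Ioi (-δ), HasDerivAt κ (κ' x) x) (hκ' : ContinuousOn κ' (Ioi (-δ)))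
    (hy : Continuous y) {t : ℝ} (ht : 0 ≤ t) :
    regMemory κ κ' y t =
      κ t * ‖y t‖ ^ 2 / 2 - (∫ τ in (0 : ℝ)..t, κ' (t - τ) * ‖y t - y τ‖ ^ 2) / 2 := by
  rw [integral_kernel_norm_sub_sq hδ hκ hκ' hy ht, regMemory]
  ring

/-- In the expanded form only `κ'` and the outer value `y t` are differentiated, so `y` needs a
derivative at `t` alone. Completing the square again, now with `κ''` in place of `κ'`, turns the
remainder into terms of definite sign for a decreasing convex kernel. -/
theorem hasDerivAt_regMemory (hδ : 0 < δ)
    (hκ' : ∀ x ∈ Ioi (-δ), HasDerivAt κ' (κ'' x) x) (hκ'' : ContinuousOn κ'' (Ioi (-δ)))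
    (hy : Continuous y) {t : ℝ} (ht : 0 ≤ t) {y' : K} (hy' : HasDerivAt y y' t) :
    HasDerivAt (regMemory κ κ' y) (inner ℝ y' (regCaputo κ κ' y t)
      + (κ' t * ‖y t‖ ^ 2 - ∫ τ in (0 : ℝ)..t, κ'' (t - τ) * ‖y t - y τ‖ ^ 2) / 2) t := by
  have h1 := hasDerivAt_convolution hδ hκ' hκ'' hy ht
  have h2 := hasDerivAt_convolution hδ hκ' hκ'' (f := fun τ => ‖y τ‖ ^ 2) (by fun_prop) ht
  have h3 := ((hy'.norm_sq.const_mul (κ 0)).div_const 2).add (hy'.inner ℝ h1)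
  have h4 := h3.sub (h2.div_const 2)
  refine h4.congr_deriv ?_
  rw [integral_kernel_norm_sub_sq hδ hκ' hκ'' hy ht]
  simp only [regCaputo, inner_add_right, inner_smul_right, real_inner_self_eq_norm_sq, smul_eq_mul,
    real_inner_comm y' (y t)]
  ring

/-- Integration by parts. Continuity up to the endpoints and integrability of `y'` suffice, and `y 0
= 0` removes the boundary term at zero. -/
theorem regCaputo_eq_integral (hδ : 0 < δ)
    (hκ : ∀ x ∈ Ioi (-δ), HasDerivAt κ (κ' x) x) (hκ' : ContinuousOn κ' (Ioi (-δ)))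
    (hy : Continuous y) (hy0 : y 0 = 0) {t : ℝ} (ht : 0 ≤ t) {y' : ℝ → K}
    (hy' : ∀ τ ∈ Ioo 0 t, HasDerivAt y (y' τ) τ)
    (hint : IntervalIntegrable y' volume 0 t) :
    regCaputo κ κ' y t = ∫ τ in (0 : ℝ)..t, κ (t - τ) • y' τ := by
  have hκc : ContinuousOn κ (Ioi (-δ)) := fun x hx => (hκ x hx).continuousAt.continuousWithinAt
  have hm : ∀ x ∈ Icc 0 t, t - x ∈ Ioi (-δ) := fun x hx => by
    simp only [mem_Ioi]; linarith [hx.2]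
  have i1 : IntervalIntegrable (fun τ => κ (t - τ) • y' τ) volume 0 t := by
    refine hint.continuousOn_smul (hκc.comp (by fun_prop) ?_)
    rw [uIcc_of_le ht]
    exact hm
  have i2 := intervalIntegrable_kernel_smul (x := t) (a := 0) (b := t) hκ' hy
    (by linarith) (by linarith)
  have h := intervalIntegral.integral_eq_sub_of_hasDerivAt_of_le
    (f := fun τ => κ (t - τ) • y τ) (f' := fun τ => κ (t - τ) • y' τ - κ' (t - τ) • y τ) ht
    (ContinuousOn.smul (hκc.comp (by fun_prop) hm) hy.continuousOn) (fun τ hτ => ?_)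
    (i1.sub i2)
  · rw [intervalIntegral.integral_sub i1 i2] at h
    simp only [sub_self, hy0, smul_zero, sub_zero] at h
    rw [regCaputo, ← h]
    abel
  · have h1 := (hκ (t - τ) (hm τ (Ioo_subset_Icc_self hτ))).comp τ
      ((hasDerivAt_id τ).const_sub t)
    refine (h1.smul (hy' τ hτ)).congr_deriv ?_
    simp [sub_eq_add_neg]

end RegularKernel

/-! ### The shifted power kernel -/

section PowerKernel

/-- The regularized power kernel `(t + δ)^(-p)`. -/
def shiftKernel (p δ t : ℝ) : ℝ := (t + δ) ^ (-p)

theorem hasDerivAt_shiftKernel (p δ : ℝ) {x : ℝ} (hx : x ∈ Ioi (-δ)) :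
    HasDerivAt (shiftKernel p δ) (-p * shiftKernel (p + 1) δ x) x := by
  have h : x + δ ≠ 0 := by simp only [mem_Ioi] at hx; linarith
  have := ((hasDerivAt_id x).add_const δ).rpow_const (p := -p) (Or.inl h)
  refine this.congr_deriv ?_
  simp [shiftKernel, sub_eq_add_neg, add_comm]

theorem continuousOn_shiftKernel (p δ : ℝ) : ContinuousOn (shiftKernel p δ) (Ioi (-δ)) :=
  fun _ hx => (hasDerivAt_shiftKernel p δ hx).continuousAt.continuousWithinAt

theorem shiftKernel_nonneg (p : ℝ) {δ t : ℝ} (h : 0 ≤ t + δ) : 0 ≤ shiftKernel p δ t :=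
  Real.rpow_nonneg h _

theorem shiftKernel_le {p δ t : ℝ} (hp : 0 ≤ p) (hδ : 0 ≤ δ) (ht : 0 < t) :
    shiftKernel p δ t ≤ t ^ (-p) :=
  Real.rpow_le_rpow_of_nonpos ht (by linarith) (by linarith)

theorem tendsto_shiftKernel (p : ℝ) {t : ℝ} (ht : 0 < t) :
    Tendsto (fun δ => shiftKernel p δ t) (𝓝[>] 0) (𝓝 (t ^ (-p))) := by
  have : ContinuousAt (fun δ => shiftKernel p δ t) 0 := by
    unfold shiftKernel
    exact ContinuousAt.rpow_const (by fun_prop) (Or.inl (by simpa using ht.ne'))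
  have h := this.tendsto.mono_left (nhdsWithin_le_nhds (s := Ioi 0))
  simpa [shiftKernel] using h

end PowerKernel

/-! ### Removing the shift: uniform bounds and limits as `δ → 0` -/

section Memory

variable {K : Type*} [NormedAddCommGroup K] [InnerProductSpace ℝ K]

/-- The nonlocal term of a path in a Hilbert space. -/
def memoryTerm (β : ℝ) (y : ℝ → K) (t : ℝ) : ℝ :=
  ‖y t‖ ^ 2 / (2 * t ^ β) + β / 2 * ∫ τ in Ioo 0 t, ‖y t - y τ‖ ^ 2 / (t - τ) ^ (β + 1)

/-- The weakly singular integral `∫₀ᵗ (t-τ)^(-α) y'(τ) dτ`. -/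
def fracConv (α : ℝ) (y' : ℝ → K) (t : ℝ) : K :=
  ∫ τ in Ioo 0 t, ((t - τ) ^ α)⁻¹ • y' τ

/-- A path starting at zero, of class `C¹` on `(0,T)` with integrable derivative, whose nonlocal
term is well-defined. -/
structure MemoryPath (α T : ℝ) (y y' : ℝ → K) : Prop where
  pos : 0 < α
  lt_one : α < 1
  continuous : Continuous y
  zero : y 0 = 0
  hasDerivAt : ∀ τ ∈ Ioo 0 T, HasDerivAt y (y' τ) τ
  continuousOn_deriv : ContinuousOn y' (Ioo 0 T)
  integrableOn_deriv : IntegrableOn y' (Ioo 0 T)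
  integrableOn_memory : ∀ t ∈ Ioc 0 T,
    IntegrableOn (fun τ => ‖y t - y τ‖ ^ 2 / (t - τ) ^ (α + 1)) (Ioo 0 t)

/-- The nonlocal term with the kernel `(t + δ)^(-α)`. -/
def shiftMemory (α δ : ℝ) (y : ℝ → K) : ℝ → ℝ :=
  regMemory (shiftKernel α δ) (fun x => -α * shiftKernel (α + 1) δ x) y

/-- The Caputo type convolution with the kernel `(t + δ)^(-α)`. -/
def shiftCaputo (α δ : ℝ) (y : ℝ → K) : ℝ → K :=
  regCaputo (shiftKernel α δ) (fun x => -α * shiftKernel (α + 1) δ x) y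

theorem continuousOn_const_mul_shiftKernel (c p δ : ℝ) :
    ContinuousOn (fun x => c * shiftKernel p δ x) (Ioi (-δ)) :=
  (continuousOn_shiftKernel p δ).const_smul c

theorem integrableOn_sub_rpow_neg {α r : ℝ} (hα1 : α < 1) :
    IntegrableOn (fun τ => (r - τ) ^ (-α)) (Ioo 0 r) := by
  rcases le_or_gt r 0 with h | h
  · simp [Ioo_eq_empty (not_lt.2 h)]
  have := (intervalIntegral.intervalIntegrable_rpow' (a := 0) (b := r) (r := -α)
    (by linarith)).comp_sub_left r
  simp only [sub_self, sub_zero] at this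
  exact (intervalIntegrable_iff_integrableOn_Ioo_of_le h.le).1 this.symm

theorem setIntegral_sub_rpow_neg {α r : ℝ} (hα1 : α < 1) (hr : 0 ≤ r) :
    ∫ τ in Ioo 0 r, (r - τ) ^ (-α) = r ^ (1 - α) / (1 - α) := by
  rw [← integral_Ioc_eq_integral_Ioo, ← intervalIntegral.integral_of_le hr,
    intervalIntegral.integral_comp_sub_left (fun x => x ^ (-α)) r, integral_rpow (by left; linarith)]
  simp only [sub_self, sub_zero]
  rw [Real.zero_rpow (by linarith), sub_zero, show -α + 1 = 1 - α by ring]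

omit [InnerProductSpace ℝ K] in
theorem memoryTerm_eq (α : ℝ) (y : ℝ → K) {t : ℝ} (ht : 0 < t) :
    memoryTerm α y t = t ^ (-α) * ‖y t‖ ^ 2 / 2
      + α / 2 * ∫ τ in Ioo 0 t, (t - τ) ^ (-(α + 1)) * ‖y t - y τ‖ ^ 2 := by
  rw [memoryTerm]
  congr 1
  · rw [Real.rpow_neg ht.le]
    have := (Real.rpow_pos_of_pos ht α).ne'
    field_simp
  · congr 1
    refine setIntegral_congr_fun measurableSet_Ioo fun τ hτ => ?_
    rw [Real.rpow_neg (by linarith [hτ.2]), div_eq_inv_mul]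

omit [InnerProductSpace ℝ K] in
-- Split at `s / 2`: before it the kernel is at most `(s/2)^(-α)` and `y'` is integrable; after it
-- `y'` is bounded by compactness and the kernel is integrable. The bound is uniform in `r ∈ [s,
-- t]`, which later permits dominated convergence in time.
theorem exists_bound_singular_integral {α T : ℝ} {y' : ℝ → K} (hα0 : 0 < α) (hα1 : α < 1)
    (hc : ContinuousOn y' (Ioo 0 T)) (hint : IntegrableOn y' (Ioo 0 T)) {s t : ℝ}
    (hs : 0 < s) (ht : t < T) :
    ∃ B, ∀ r ∈ Icc s t, IntegrableOn (fun τ => (r - τ) ^ (-α) * ‖y' τ‖) (Ioo 0 r) ∧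
      ∫ τ in Ioo 0 r, (r - τ) ^ (-α) * ‖y' τ‖ ≤ B := by
  obtain ⟨M, hM⟩ := (isCompact_Icc (a := s / 2) (b := t)).exists_bound_of_continuousOn
    (hc.mono fun x hx => ⟨by linarith [hx.1], by linarith [hx.2]⟩)
  refine ⟨(s / 2) ^ (-α) * (∫ τ in Ioo 0 T, ‖y' τ‖) + |M| * (t ^ (1 - α) / (1 - α)), ?_⟩
  intro r hr
  have hrT : r < T := hr.2.trans_lt ht
  have hr0 : 0 < r := hs.trans_le hr.1
  have hi : IntegrableOn (fun τ => ‖y' τ‖) (Ioo 0 r) :=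
    (hint.mono_set (Ioo_subset_Ioo_right hrT.le)).norm
  have hi1 : IntegrableOn (fun τ => (s / 2) ^ (-α) * ‖y' τ‖ + |M| * (r - τ) ^ (-α)) (Ioo 0 r) :=
    (hi.const_mul _).add ((integrableOn_sub_rpow_neg hα1).const_mul _)
  have hle : ∀ τ ∈ Ioo 0 r,
      (r - τ) ^ (-α) * ‖y' τ‖ ≤ (s / 2) ^ (-α) * ‖y' τ‖ + |M| * (r - τ) ^ (-α) := by
    intro τ hτ
    have h0 : 0 ≤ (r - τ) ^ (-α) := Real.rpow_nonneg (by linarith [hτ.2]) _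
    have h1 : 0 ≤ (s / 2) ^ (-α) := Real.rpow_nonneg (by linarith) _
    rcases le_or_gt τ (s / 2) with h2 | h2
    · have : (r - τ) ^ (-α) ≤ (s / 2) ^ (-α) :=
        Real.rpow_le_rpow_of_nonpos (by linarith) (by linarith [hr.1]) (by linarith)
      have := mul_le_mul_of_nonneg_right this (norm_nonneg (y' τ))
      have := mul_nonneg (abs_nonneg M) h0
      linarith
    · have : ‖y' τ‖ ≤ |M| := (hM τ ⟨h2.le, hτ.2.le.trans hr.2⟩).trans (le_abs_self M)
      have := mul_le_mul_of_nonneg_left this h0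
      have := mul_nonneg h1 (norm_nonneg (y' τ))
      linarith
  have hi2 : IntegrableOn (fun τ => (r - τ) ^ (-α) * ‖y' τ‖) (Ioo 0 r) := by
    refine Integrable.mono' hi1 ?_ ?_
    · exact (integrableOn_sub_rpow_neg hα1).aestronglyMeasurable.mul hi.aestronglyMeasurable
    · filter_upwards [ae_restrict_mem measurableSet_Ioo] with τ hτ
      rw [Real.norm_of_nonneg (mul_nonneg (Real.rpow_nonneg (by linarith [hτ.2]) _)
        (norm_nonneg _))]
      exact hle τ hτ
  refine ⟨hi2, (setIntegral_mono_on hi2 hi1 measurableSet_Ioo hle).trans ?_⟩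
  rw [integral_add (hi.const_mul _) ((integrableOn_sub_rpow_neg hα1).const_mul _),
    integral_const_mul, integral_const_mul, setIntegral_sub_rpow_neg hα1 hr0.le]
  have h1α : 0 < 1 - α := by linarith
  gcongr
  · exact Eventually.of_forall fun _ => norm_nonneg _
  · exact hint.norm
  · exact hr.2

namespace MemoryPath

variable {α T : ℝ} {y y' : ℝ → K}

theorem exists_bound (h : MemoryPath α T y y') {s t : ℝ} (hs : 0 < s) (ht : t < T) :
    ∃ B, ∀ r ∈ Icc s t, IntegrableOn (fun τ => (r - τ) ^ (-α) * ‖y' τ‖) (Ioo 0 r) ∧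
      ∫ τ in Ioo 0 r, (r - τ) ^ (-α) * ‖y' τ‖ ≤ B :=
  exists_bound_singular_integral h.pos h.lt_one h.continuousOn_deriv h.integrableOn_deriv hs ht

theorem norm_shiftKernel_smul_le (h : MemoryPath α T y y') {δ : ℝ} (hδ : 0 < δ) {t τ : ℝ}
    (hτ : τ ∈ Ioo 0 t) : ‖shiftKernel α δ (t - τ) • y' τ‖ ≤ (t - τ) ^ (-α) * ‖y' τ‖ := by
  rw [norm_smul, Real.norm_of_nonneg (shiftKernel_nonneg _ (by linarith [hτ.2]))]
  gcongr
  exact shiftKernel_le h.pos.le hδ.le (by linarith [hτ.2])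

theorem integrableOn_rpow_mul (h : MemoryPath α T y y') {t : ℝ} (ht : t ∈ Ioc 0 T) :
    IntegrableOn (fun τ => (t - τ) ^ (-(α + 1)) * ‖y t - y τ‖ ^ 2) (Ioo 0 t) := by
  refine (h.integrableOn_memory t ht).congr_fun (fun τ hτ => ?_) measurableSet_Ioo
  simp only
  rw [Real.rpow_neg (by linarith [hτ.2]), div_eq_inv_mul]

theorem continuousOn_shiftKernel_mul (h : MemoryPath α T y y') {δ : ℝ} (hδ : 0 < δ) (t : ℝ) :
    ContinuousOn (fun τ => shiftKernel (α + 1) δ (t - τ) * ‖y t - y τ‖ ^ 2) (Icc 0 t) := by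
  have := h.continuous
  refine ContinuousOn.mul ?_ (by fun_prop)
  refine (continuousOn_shiftKernel _ δ).comp (by fun_prop) fun τ hτ => ?_
  simp only [mem_Ioi]
  linarith [hτ.2]

variable [CompleteSpace K]

theorem shiftCaputo_eq (h : MemoryPath α T y y') {δ : ℝ} (hδ : 0 < δ) {t : ℝ}
    (ht : t ∈ Ioo 0 T) :
    shiftCaputo α δ y t = ∫ τ in Ioo 0 t, shiftKernel α δ (t - τ) • y' τ := by
  rw [shiftCaputo, regCaputo_eq_integral hδ (fun x hx => hasDerivAt_shiftKernel α δ hx)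
    (continuousOn_const_mul_shiftKernel _ _ _) h.continuous h.zero ht.1.le (y' := y')
    (fun τ hτ => h.hasDerivAt τ ⟨hτ.1, hτ.2.trans ht.2⟩), intervalIntegral.integral_of_le ht.1.le,
    integral_Ioc_eq_integral_Ioo]
  exact (intervalIntegrable_iff_integrableOn_Ioo_of_le ht.1.le).2
    (h.integrableOn_deriv.mono_set (Ioo_subset_Ioo_right ht.2.le))

theorem norm_shiftCaputo_le (h : MemoryPath α T y y') {δ : ℝ} (hδ : 0 < δ) {t : ℝ}
    (ht : t ∈ Ioo 0 T) :
    ‖shiftCaputo α δ y t‖ ≤ ∫ τ in Ioo 0 t, (t - τ) ^ (-α) * ‖y' τ‖ := by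
  rw [h.shiftCaputo_eq hδ ht]
  obtain ⟨B, hB⟩ := h.exists_bound ht.1 ht.2
  refine norm_integral_le_of_norm_le (hB t ⟨le_rfl, le_rfl⟩).1 ?_
  filter_upwards [ae_restrict_mem measurableSet_Ioo] with τ hτ
  exact h.norm_shiftKernel_smul_le hδ hτ

theorem tendsto_shiftCaputo (h : MemoryPath α T y y') {t : ℝ} (ht : t ∈ Ioo 0 T) :
    Tendsto (fun δ => shiftCaputo α δ y t) (𝓝[>] 0) (𝓝 (fracConv α y' t)) := by
  obtain ⟨B, hB⟩ := h.exists_bound ht.1 ht.2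
  have hi := h.integrableOn_deriv.mono_set (Ioo_subset_Ioo_right ht.2.le)
  have key : Tendsto (fun δ => ∫ τ in Ioo 0 t, shiftKernel α δ (t - τ) • y' τ) (𝓝[>] 0)
      (𝓝 (fracConv α y' t)) := by
    refine tendsto_integral_filter_of_dominated_convergence
      (fun τ => (t - τ) ^ (-α) * ‖y' τ‖) ?_ ?_ (hB t ⟨le_rfl, le_rfl⟩).1 ?_
    · filter_upwards [self_mem_nhdsWithin] with δ hδ
      refine AEStronglyMeasurable.smul ?_ hi.aestronglyMeasurable
      refine ContinuousOn.aestronglyMeasurable ?_ measurableSet_Ioo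
      refine (continuousOn_shiftKernel α δ).comp (by fun_prop) fun τ hτ => ?_
      simp only [mem_Ioi] at *
      linarith [hτ.2]
    · filter_upwards [self_mem_nhdsWithin] with δ hδ
      filter_upwards [ae_restrict_mem measurableSet_Ioo] with τ hτ
      exact h.norm_shiftKernel_smul_le hδ hτ
    · filter_upwards [ae_restrict_mem measurableSet_Ioo] with τ hτ
      have hp : 0 < t - τ := by linarith [hτ.2]
      have := (tendsto_shiftKernel α hp).smul_const (y' τ)
      rwa [Real.rpow_neg hp.le] at this
  refine key.congr' ?_
  filter_upwards [self_mem_nhdsWithin] with δ hδ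
  exact (h.shiftCaputo_eq hδ ht).symm

theorem shiftMemory_eq (h : MemoryPath α T y y') {δ : ℝ} (hδ : 0 < δ) {t : ℝ} (ht : 0 ≤ t) :
    shiftMemory α δ y t = shiftKernel α δ t * ‖y t‖ ^ 2 / 2
      + α / 2 * ∫ τ in Ioo 0 t, shiftKernel (α + 1) δ (t - τ) * ‖y t - y τ‖ ^ 2 := by
  rw [shiftMemory, regMemory_eq hδ (fun x hx => hasDerivAt_shiftKernel α δ hx)
    (continuousOn_const_mul_shiftKernel _ _ _) h.continuous ht]
  simp_rw [mul_assoc]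
  rw [intervalIntegral.integral_const_mul, intervalIntegral.integral_of_le ht,
    integral_Ioc_eq_integral_Ioo]
  ring

theorem shiftMemory_le (h : MemoryPath α T y y') {δ : ℝ} (hδ : 0 < δ) {t : ℝ}
    (ht : t ∈ Ioc 0 T) : shiftMemory α δ y t ≤ memoryTerm α y t := by
  rw [h.shiftMemory_eq hδ ht.1.le, memoryTerm_eq α y ht.1]
  have hα0 := h.pos
  gcongr ?_ * _ / _ + _ * ?_
  · exact shiftKernel_le h.pos.le hδ.le ht.1
  · refine setIntegral_mono_on ?_ (h.integrableOn_rpow_mul ht) measurableSet_Ioo fun τ hτ => ?_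
    · exact ((h.continuousOn_shiftKernel_mul hδ t).integrableOn_Icc).mono_set Ioo_subset_Icc_self
    · gcongr
      exact shiftKernel_le (by linarith) hδ.le (by linarith [hτ.2])

theorem tendsto_shiftMemory (h : MemoryPath α T y y') {t : ℝ} (ht : t ∈ Ioc 0 T) :
    Tendsto (fun δ => shiftMemory α δ y t) (𝓝[>] 0) (𝓝 (memoryTerm α y t)) := by
  have hα0 := h.pos
  have h1 : Tendsto (fun δ => ∫ τ in Ioo 0 t, shiftKernel (α + 1) δ (t - τ) * ‖y t - y τ‖ ^ 2)
      (𝓝[>] 0) (𝓝 (∫ τ in Ioo 0 t, (t - τ) ^ (-(α + 1)) * ‖y t - y τ‖ ^ 2)) := by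
    refine tendsto_integral_filter_of_dominated_convergence
      (fun τ => (t - τ) ^ (-(α + 1)) * ‖y t - y τ‖ ^ 2) ?_ ?_ (h.integrableOn_rpow_mul ht) ?_
    · filter_upwards [self_mem_nhdsWithin] with δ hδ
      exact ((h.continuousOn_shiftKernel_mul hδ t).mono
        Ioo_subset_Icc_self).aestronglyMeasurable measurableSet_Ioo
    · filter_upwards [self_mem_nhdsWithin] with δ hδ
      rw [mem_Ioi] at hδ
      filter_upwards [ae_restrict_mem measurableSet_Ioo] with τ hτ
      rw [Real.norm_of_nonneg (mul_nonneg (shiftKernel_nonneg _ (by linarith [hτ.2]))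
        (sq_nonneg _))]
      gcongr
      exact shiftKernel_le (by linarith) hδ.le (by linarith [hτ.2])
    · filter_upwards [ae_restrict_mem measurableSet_Ioo] with τ hτ
      exact (tendsto_shiftKernel (α + 1) (by linarith [hτ.2])).mul_const _
  have h2 := (((tendsto_shiftKernel α ht.1).mul_const (‖y t‖ ^ 2)).div_const 2).add
    (h1.const_mul (α / 2))
  rw [← memoryTerm_eq α y ht.1] at h2
  refine h2.congr' ?_
  filter_upwards [self_mem_nhdsWithin] with δ hδ
  exact (h.shiftMemory_eq hδ ht.1.le).symm

end MemoryPath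
end Memory

/-! ### Chain rule inequality and behaviour near time zero -/

namespace MemoryPath

variable {K : Type*} [NormedAddCommGroup K] [InnerProductSpace ℝ K] [CompleteSpace K]
  {α T : ℝ} {y y' : ℝ → K}

theorem continuousAt_shiftCaputo (h : MemoryPath α T y y') {δ : ℝ} (hδ : 0 < δ) {t : ℝ}
    (ht : 0 ≤ t) : ContinuousAt (shiftCaputo α δ y) t := by
  have hy := h.continuous
  refine ContinuousAt.add (by fun_prop) ?_
  exact (hasDerivAt_convolution hδ
    (fun x hx => (hasDerivAt_shiftKernel (α + 1) δ hx).const_mul (-α))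
    ((continuousOn_const_mul_shiftKernel _ _ _).const_smul (-α)) h.continuous ht).continuousAt

theorem continuousAt_shiftMemory (h : MemoryPath α T y y') {δ : ℝ} (hδ : 0 < δ) {t : ℝ}
    (ht : 0 ≤ t) : ContinuousAt (shiftMemory α δ y) t := by
  have hy := h.continuous
  have h1 := h.continuousAt_shiftCaputo hδ ht
  have h2 := (hasDerivAt_convolution hδ
    (fun x hx => (hasDerivAt_shiftKernel (α + 1) δ hx).const_mul (-α))
    ((continuousOn_const_mul_shiftKernel _ _ _).const_smul (-α)) (f := fun τ => ‖y τ‖ ^ 2)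
    (by fun_prop) ht).continuousAt
  have e : shiftMemory α δ y = fun t => inner ℝ (y t) (shiftCaputo α δ y t)
      - (shiftKernel α δ 0 • ‖y t‖ ^ 2
        + ∫ τ in (0 : ℝ)..t, (-α * shiftKernel (α + 1) δ (t - τ)) • ‖y τ‖ ^ 2) / 2 :=
    funext fun t => regMemory_eq_inner_regCaputo _ _ _ _
  rw [e]
  exact (hy.continuousAt.inner h1).sub ((ContinuousAt.add (by fun_prop) h2).div_const 2)

/-- The two remainder terms are nonpositive because the kernel is decreasing and convex. -/
theorem hasDerivAt_shiftMemory_le (h : MemoryPath α T y y') {δ : ℝ} (hδ : 0 < δ) {t : ℝ}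
    (ht : t ∈ Ioo 0 T) : ∃ e, e ≤ inner ℝ (y' t) (shiftCaputo α δ y t) ∧
      HasDerivAt (shiftMemory α δ y) e t := by
  have hα0 := h.pos
  refine ⟨_, ?_, hasDerivAt_regMemory hδ
    (fun x hx => (hasDerivAt_shiftKernel (α + 1) δ hx).const_mul (-α))
    ((continuousOn_const_mul_shiftKernel _ _ _).const_smul (-α)) h.continuous ht.1.le
    (h.hasDerivAt t ht)⟩
  have h1 : 0 ≤ shiftKernel (α + 1) δ t := shiftKernel_nonneg _ (by linarith [ht.1])
  have h2 : 0 ≤ ∫ τ in (0 : ℝ)..t,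
      (-α * (-(α + 1) * shiftKernel (α + 1 + 1) δ (t - τ))) * ‖y t - y τ‖ ^ 2 := by
    refine intervalIntegral.integral_nonneg ht.1.le fun τ hτ => ?_
    have : 0 ≤ shiftKernel (α + 1 + 1) δ (t - τ) := shiftKernel_nonneg _ (by linarith [hτ.2])
    rw [show (-α * (-(α + 1) * shiftKernel (α + 1 + 1) δ (t - τ)))
      = α * (α + 1) * shiftKernel (α + 1 + 1) δ (t - τ) by ring]
    positivity
  have h3 : -α * shiftKernel (α + 1) δ t * ‖y t‖ ^ 2 ≤ 0 := by
    have : 0 ≤ α * shiftKernel (α + 1) δ t * ‖y t‖ ^ 2 := by positivity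
    linarith
  have h4 : inner ℝ (y' t) (shiftCaputo α δ y t) = inner ℝ (y' t) (regCaputo (shiftKernel α δ)
    (fun x => -α * shiftKernel (α + 1) δ x) y t) := rfl
  linarith

theorem shiftMemory_sub_le (h : MemoryPath α T y y') {δ : ℝ} (hδ : 0 < δ) {s t : ℝ}
    (hs : 0 < s) (hst : s ≤ t) (ht : t < T) :
    shiftMemory α δ y t - shiftMemory α δ y s
      ≤ ∫ r in s..t, inner ℝ (y' r) (shiftCaputo α δ y r) := by
  have hsub : ∀ r ∈ Icc s t, r ∈ Ioo 0 T := fun r hr => ⟨hs.trans_le hr.1, hr.2.trans_lt ht⟩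
  choose! e he1 he2 using fun r (hr : r ∈ Ioo 0 T) => h.hasDerivAt_shiftMemory_le hδ hr
  refine intervalIntegral.sub_le_integral_of_hasDeriv_right_of_le hst
    (fun r hr => (he2 r (hsub r hr)).continuousAt.continuousWithinAt)
    (fun r hr => (he2 r (hsub r (Ioo_subset_Icc_self hr))).hasDerivWithinAt) ?_
    (fun r hr => he1 r (hsub r (Ioo_subset_Icc_self hr)))
  refine ContinuousOn.integrableOn_Icc (ContinuousOn.inner (h.continuousOn_deriv.mono hsub) ?_)
  exact fun r hr => (h.continuousAt_shiftCaputo hδ (hsub r hr).1.le).continuousWithinAt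

theorem tendsto_integral_inner_shiftCaputo (h : MemoryPath α T y y') {s t : ℝ}
    (hs : 0 < s) (hst : s ≤ t) (ht : t < T) {z : ℝ → K} (hz : ContinuousOn z (Ioo 0 T)) :
    Tendsto (fun δ => ∫ r in s..t, inner ℝ (z r) (shiftCaputo α δ y r)) (𝓝[>] 0)
      (𝓝 (∫ r in s..t, inner ℝ (z r) (fracConv α y' r))) := by
  have hsub : ∀ r ∈ Icc s t, r ∈ Ioo 0 T := fun r hr => ⟨hs.trans_le hr.1, hr.2.trans_lt ht⟩
  obtain ⟨B, hB⟩ := h.exists_bound hs ht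
  have huI : ∀ r ∈ uIoc s t, r ∈ Icc s t := fun r hr => by
    rw [uIoc_of_le hst] at hr; exact Ioc_subset_Icc_self hr
  refine intervalIntegral.tendsto_integral_filter_of_dominated_convergence
    (fun r => ‖z r‖ * B) ?_ ?_ ?_ ?_
  · filter_upwards [self_mem_nhdsWithin] with δ hδ
    rw [uIoc_of_le hst]
    refine ContinuousOn.aestronglyMeasurable (ContinuousOn.inner ?_ ?_) measurableSet_Ioc
    · exact hz.mono fun r hr => hsub r (Ioc_subset_Icc_self hr)
    · exact fun r hr => (h.continuousAt_shiftCaputo hδ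
        (hsub r (Ioc_subset_Icc_self hr)).1.le).continuousWithinAt
  · filter_upwards [self_mem_nhdsWithin] with δ hδ
    refine Eventually.of_forall fun r hr => (norm_inner_le_norm _ _).trans ?_
    gcongr
    exact (h.norm_shiftCaputo_le hδ (hsub r (huI r hr))).trans (hB r (huI r hr)).2
  · refine ContinuousOn.intervalIntegrable ?_
    rw [uIcc_of_le hst]
    exact ((hz.mono hsub).norm).mul continuousOn_const
  · refine Eventually.of_forall fun r hr => ?_
    exact tendsto_const_nhds.inner (h.tendsto_shiftCaputo (hsub r (huI r hr)))

theorem intervalIntegrable_inner_fracConv (h : MemoryPath α T y y') {s t : ℝ}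
    (hs : 0 < s) (hst : s ≤ t) (ht : t < T) {z : ℝ → K} (hz : ContinuousOn z (Ioo 0 T)) :
    IntervalIntegrable (fun r => inner ℝ (z r) (fracConv α y' r)) volume s t := by
  have hsub : ∀ r ∈ Icc s t, r ∈ Ioo 0 T := fun r hr => ⟨hs.trans_le hr.1, hr.2.trans_lt ht⟩
  obtain ⟨B, hB⟩ := h.exists_bound hs ht
  obtain ⟨C, hC⟩ := (isCompact_Icc (a := s) (b := t)).exists_bound_of_continuousOn (hz.mono hsub)
  rw [intervalIntegrable_iff_integrableOn_Icc_of_le hst]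
  refine Integrable.of_bound (C := C * B) ?_ ?_
  -- Measurability of the singular convolution in time is obtained as a pointwise limit of the
  -- continuous regularized pairings along `δ = 1/(n+1)`.
  · have hm : ∀ n : ℕ, AEStronglyMeasurable
        (fun r => inner ℝ (z r) (shiftCaputo α ((1 : ℝ) / (n + 1)) y r))
        (volume.restrict (Icc s t)) := fun n =>
      (ContinuousOn.inner (hz.mono hsub) fun r hr => (h.continuousAt_shiftCaputo (by positivity)
        (hsub r hr).1.le).continuousWithinAt).aestronglyMeasurable measurableSet_Icc
    refine aestronglyMeasurable_of_tendsto_ae atTop hm ?_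
    filter_upwards [ae_restrict_mem measurableSet_Icc] with r hr
    refine tendsto_const_nhds.inner ((h.tendsto_shiftCaputo (hsub r hr)).comp
      (tendsto_nhdsWithin_iff.2 ⟨tendsto_one_div_add_atTop_nhds_zero_nat,
        Eventually.of_forall fun n => ?_⟩))
    simp only [mem_Ioi]
    positivity
  · filter_upwards [ae_restrict_mem measurableSet_Icc] with r hr
    have h1 : ‖fracConv α y' r‖ ≤ B := by
      refine le_of_tendsto (h.tendsto_shiftCaputo (hsub r hr)).norm ?_
      filter_upwards [self_mem_nhdsWithin] with δ hδ
      exact (h.norm_shiftCaputo_le hδ (hsub r hr)).trans (hB r hr).2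
    refine (norm_inner_le_norm _ _).trans ?_
    have := hC r hr
    have := norm_nonneg (z r)
    gcongr
    linarith

/-- The chain rule inequality for the nonlocal term. -/
theorem memoryTerm_sub_le (h : MemoryPath α T y y') {s t : ℝ}
    (hs : 0 < s) (hst : s ≤ t) (ht : t < T) :
    memoryTerm α y t - memoryTerm α y s ≤ ∫ r in s..t, inner ℝ (y' r) (fracConv α y' r) := by
  refine le_of_tendsto_of_tendsto
    ((h.tendsto_shiftMemory ⟨hs.trans_le hst, ht.le⟩).sub
      (h.tendsto_shiftMemory ⟨hs, hst.trans ht.le⟩))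
    (h.tendsto_integral_inner_shiftCaputo hs hst ht h.continuousOn_deriv) ?_
  filter_upwards [self_mem_nhdsWithin] with δ hδ
  exact h.shiftMemory_sub_le hδ hs hst ht

/-- The correction term integrates to `(M t - M s) / 2`; `M t ≥ 0` is discarded, and `M s` is
bounded uniformly in `δ` by a quantity of order `s^(1-α)`. -/
theorem integral_shiftMemory_le (h : MemoryPath α T y y') {δ : ℝ} (hδ : 0 < δ) {s t P : ℝ}
    (hs : 0 < s) (hst : s ≤ t) (hP : ∀ τ ∈ Icc 0 s, ‖y τ‖ ^ 2 ≤ P) :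
    ∫ r in s..t, shiftMemory α δ y r ≤
      (∫ r in s..t, inner ℝ (y r) (shiftCaputo α δ y r)) + P * (s ^ (1 - α) / (1 - α)) / 2 := by
  have hα0 := h.pos
  have hy := h.continuous
  set M : ℝ → ℝ := fun t => ∫ τ in (0 : ℝ)..t, shiftKernel α δ (t - τ) • ‖y τ‖ ^ 2
  set M' : ℝ → ℝ := fun t => shiftKernel α δ 0 • ‖y t‖ ^ 2
    + ∫ τ in (0 : ℝ)..t, (-α * shiftKernel (α + 1) δ (t - τ)) • ‖y τ‖ ^ 2 with hM'
  have hM : ∀ r, 0 ≤ r → HasDerivAt M (M' r) r := fun r hr =>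
    hasDerivAt_convolution hδ (fun x hx => hasDerivAt_shiftKernel α δ hx)
      (continuousOn_const_mul_shiftKernel _ _ _) (by fun_prop) hr
  have e : ∀ r, shiftMemory α δ y r = inner ℝ (y r) (shiftCaputo α δ y r) - M' r / 2 :=
    fun r => regMemory_eq_inner_regCaputo _ _ _ _
  have hr0 : ∀ r ∈ uIcc s t, 0 ≤ r := fun r hr => by
    rw [uIcc_of_le hst] at hr; exact hs.le.trans hr.1
  have hM'c : ContinuousOn M' (uIcc s t) := by
    intro r hr
    refine ContinuousAt.continuousWithinAt (ContinuousAt.add (by fun_prop) ?_)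
    exact (hasDerivAt_convolution hδ
      (fun x hx => (hasDerivAt_shiftKernel (α + 1) δ hx).const_mul (-α))
      ((continuousOn_const_mul_shiftKernel _ _ _).const_smul (-α)) (f := fun τ => ‖y τ‖ ^ 2)
      (by fun_prop) (hr0 r hr)).continuousAt
  have hi1 : IntervalIntegrable (fun r => inner ℝ (y r) (shiftCaputo α δ y r)) volume s t :=
    ContinuousOn.intervalIntegrable fun r hr => (hy.continuousAt.inner
      (h.continuousAt_shiftCaputo hδ (hr0 r hr))).continuousWithinAt
  simp_rw [e]
  rw [intervalIntegral.integral_sub hi1 (hM'c.intervalIntegrable.div_const 2),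
    intervalIntegral.integral_div, intervalIntegral.integral_eq_sub_of_hasDerivAt
      (fun r hr => hM r (hr0 r hr)) hM'c.intervalIntegrable]
  have h1 : 0 ≤ M t := by
    refine intervalIntegral.integral_nonneg (hs.le.trans hst) fun τ hτ => ?_
    have : 0 ≤ shiftKernel α δ (t - τ) := shiftKernel_nonneg _ (by linarith [hτ.2])
    simp only [smul_eq_mul]
    positivity
  have h2 : M s ≤ P * (s ^ (1 - α) / (1 - α)) := by
    rw [← setIntegral_sub_rpow_neg h.lt_one hs.le, ← integral_const_mul]
    simp only [M]
    rw [intervalIntegral.integral_of_le hs.le, integral_Ioc_eq_integral_Ioo]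
    refine setIntegral_mono_on ?_ ((integrableOn_sub_rpow_neg h.lt_one).const_mul P)
      measurableSet_Ioo fun τ hτ => ?_
    · exact (intervalIntegrable_iff_integrableOn_Ioo_of_le hs.le).1
        (intervalIntegrable_kernel_smul (continuousOn_shiftKernel α δ) (by fun_prop)
          (by linarith) (by linarith))
    · rw [smul_eq_mul, mul_comm]
      have := hP τ (Ioo_subset_Icc_self hτ)
      have h3 : (0 : ℝ) ≤ P := (sq_nonneg _).trans this
      have h4 : 0 < s - τ := by linarith [hτ.2]
      gcongr
      · exact shiftKernel_nonneg _ (by linarith)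
      · exact shiftKernel_le h.pos.le hδ.le h4
  linarith

/-- If the nonlocal term stays above `η` near zero, so does the bound on `⟨y, ∂^α y⟩`. -/
theorem le_of_forall_le_memoryTerm (h : MemoryPath α T y y') {η B t : ℝ} (ht0 : 0 < t)
    (htT : t < T) (hη : ∀ r ∈ Ioo 0 t, η ≤ memoryTerm α y r)
    (hB : ∀ r ∈ Ioo 0 t, inner ℝ (y r) (fracConv α y' r) ≤ B) : η ≤ B := by
  have hα1 := h.lt_one
  have hy := h.continuous
  obtain ⟨P, hP⟩ := (isCompact_Icc (a := 0) (b := t)).exists_bound_of_continuousOn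
    (f := fun τ => ‖y τ‖ ^ 2) (by fun_prop)
  -- The time average over `[s, t]` is compared; the last term vanishes as `s → 0` since `α < 1`.
  have step : ∀ s ∈ Ioo 0 t,
      (t - s) * η ≤ (t - s) * B + P * (s ^ (1 - α) / (1 - α)) / 2 := by
    intro s hs
    have hsub : ∀ r ∈ Icc s t, r ∈ Ioo 0 T := fun r hr => ⟨hs.1.trans_le hr.1, hr.2.trans_lt htT⟩
    have huI : ∀ r ∈ uIoc s t, r ∈ Ioc s t := fun r hr => by rwa [uIoc_of_le hs.2.le] at hr
    have hae : ∀ᵐ r ∂(volume : Measure ℝ), r ∈ uIoc s t → r ∈ Ioo s t := by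
      filter_upwards [(measure_eq_zero_iff_ae_notMem.1 (Real.volume_singleton (a := t)))] with
        r hr hr'
      exact ⟨(huI r hr').1, lt_of_le_of_ne (huI r hr').2 (by simpa using hr)⟩
    -- Truncating at `η` supplies a dominating constant; by the lower bound `hη` the truncated
    -- integrand still converges to `η`.
    have hL : Tendsto (fun δ => ∫ r in s..t, min (shiftMemory α δ y r) η) (𝓝[>] 0)
        (𝓝 (∫ r in s..t, η)) := by
      refine intervalIntegral.tendsto_integral_filter_of_dominated_convergence
        (fun r => |η|) ?_ ?_ ?_ ?_
      · filter_upwards [self_mem_nhdsWithin] with δ hδ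
        refine ContinuousOn.aestronglyMeasurable ?_ measurableSet_uIoc
        intro r hr
        exact (ContinuousAt.inf (h.continuousAt_shiftMemory hδ (hs.1.le.trans (huI r hr).1.le))
          continuousAt_const).continuousWithinAt
      · filter_upwards [self_mem_nhdsWithin] with δ hδ
        refine Eventually.of_forall fun r hr => ?_
        have hr0 : 0 ≤ r := hs.1.le.trans (huI r hr).1.le
        rw [mem_Ioi] at hδ
        have hα0 := h.pos
        have hnn : 0 ≤ shiftMemory α δ y r := by
          rw [h.shiftMemory_eq hδ hr0]
          have h1 := shiftKernel_nonneg α (δ := δ) (t := r) (by linarith)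
          have h2 : 0 ≤ ∫ τ in Ioo 0 r, shiftKernel (α + 1) δ (r - τ) * ‖y r - y τ‖ ^ 2 :=
            setIntegral_nonneg measurableSet_Ioo fun τ hτ =>
              mul_nonneg (shiftKernel_nonneg _ (by linarith [hτ.2])) (sq_nonneg _)
          positivity
        rw [Real.norm_eq_abs, abs_le]
        refine ⟨le_min ?_ (neg_abs_le η), (min_le_right _ _).trans (le_abs_self η)⟩
        linarith [abs_nonneg η]
      · exact intervalIntegrable_const
      · filter_upwards [hae] with r hr hr'
        have hr2 := hr hr'
        have h0 := (h.tendsto_shiftMemory (t := r)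
          ⟨hs.1.trans hr2.1, (hr2.2.trans htT).le⟩).min (tendsto_const_nhds (x := η))
        rwa [min_eq_right (hη r ⟨hs.1.trans hr2.1, hr2.2⟩)] at h0
    have hR := (h.tendsto_integral_inner_shiftCaputo hs.1 hs.2.le htT hy.continuousOn).add_const
      (P * (s ^ (1 - α) / (1 - α)) / 2)
    have hle := le_of_tendsto_of_tendsto hL hR ?_
    · rw [intervalIntegral.integral_const, smul_eq_mul] at hle
      refine hle.trans (add_le_add_left ?_ _)
      have hcm : ∫ r in s..t, inner ℝ (y r) (fracConv α y' r) ≤ ∫ r in s..t, B := by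
        rw [intervalIntegral.integral_of_le hs.2.le, intervalIntegral.integral_of_le hs.2.le,
          integral_Ioc_eq_integral_Ioo, integral_Ioc_eq_integral_Ioo]
        have hi : IntegrableOn (fun r => inner ℝ (y r) (fracConv α y' r)) (Ioo s t) :=
          (intervalIntegrable_iff_integrableOn_Ioo_of_le hs.2.le).1
            (h.intervalIntegrable_inner_fracConv hs.1 hs.2.le htT hy.continuousOn)
        exact setIntegral_mono_on hi (by simp) measurableSet_Ioo
          fun r hr => hB r ⟨hs.1.trans hr.1, hr.2⟩
      simpa using hcm
    · filter_upwards [self_mem_nhdsWithin] with δ hδ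
      refine le_trans ?_ (h.integral_shiftMemory_le hδ hs.1 hs.2.le (P := P) ?_)
      · have hc : ContinuousOn (shiftMemory α δ y) (uIcc s t) := fun r hr => by
          rw [uIcc_of_le hs.2.le] at hr
          exact (h.continuousAt_shiftMemory hδ (hs.1.le.trans hr.1)).continuousWithinAt
        exact intervalIntegral.integral_mono_on hs.2.le
          (ContinuousOn.inf hc continuousOn_const).intervalIntegrable hc.intervalIntegrable
          fun r _ => min_le_left _ _
      · intro τ hτ
        exact (le_abs_self _).trans (hP τ ⟨hτ.1, hτ.2.trans hs.2.le⟩)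
  have hlim1 : Tendsto (fun s : ℝ => (t - s) * η) (𝓝[>] 0) (𝓝 ((t - 0) * η)) :=
    ((Continuous.tendsto (by fun_prop) 0)).mono_left nhdsWithin_le_nhds
  have hlim2 : Tendsto (fun s : ℝ => (t - s) * B + P * (s ^ (1 - α) / (1 - α)) / 2) (𝓝[>] 0)
      (𝓝 ((t - 0) * B + P * ((0 : ℝ) ^ (1 - α) / (1 - α)) / 2)) := by
    refine Tendsto.mono_left (ContinuousAt.tendsto ?_) nhdsWithin_le_nhds
    have : ContinuousAt (fun s : ℝ => s ^ (1 - α)) 0 :=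
      Real.continuousAt_rpow_const _ _ (Or.inr (by linarith))
    exact ContinuousAt.add (by fun_prop) (((this.div_const _).const_mul P).div_const 2)
  have hfin := le_of_tendsto_of_tendsto hlim1 hlim2 (by
    filter_upwards [Ioo_mem_nhdsGT ht0] with s hs
    exact step s hs)
  rw [Real.zero_rpow (by linarith)] at hfin
  simp only [sub_zero, zero_div, mul_zero, add_zero] at hfin
  exact le_of_mul_le_mul_left hfin ht0

end MemoryPath

/-! ### The energy spaces are closed linear relations -/

section EnergySpace

variable {d : ℕ} {Ω : Set (EuclideanSpace ℝ (Fin d))}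

theorem memLp_two_of_continuous (hΩb : Bornology.IsBounded Ω) {F : Type*} [NormedAddCommGroup F]
    {g : EuclideanSpace ℝ (Fin d) → F} [SecondCountableTopologyEither (EuclideanSpace ℝ (Fin d)) F]
    (hg : Continuous g) : MemLp g 2 (volume.restrict Ω) := by
  have : IsFiniteMeasure (volume.restrict Ω) :=
    ⟨by rw [Measure.restrict_apply_univ]; exact hΩb.measure_lt_top⟩
  obtain ⟨C, hC⟩ := hΩb.isCompact_closure.exists_bound_of_continuousOn hg.continuousOn
  refine MemLp.of_bound hg.aestronglyMeasurable C ?_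
  refine ae_restrict_of_ae_restrict_of_subset subset_closure ?_
  filter_upwards [ae_restrict_mem isClosed_closure.measurableSet] with x hx
  exact hC x hx

/-- On a bounded set a smooth test function and its derivative are square integrable, so the
identity is the vanishing of a continuous linear functional. Linearity and closedness of the
relation both follow. -/
theorem exists_integratesByParts_iff (hΩb : Bornology.IsBounded Ω)
    {φ : EuclideanSpace ℝ (Fin d) → ℝ} (hφ : ContDiff ℝ ∞ φ) (v : EuclideanSpace ℝ (Fin d)) :
    ∃ (a : L2 Ω) (b : L2Vec Ω), ∀ (f : L2 Ω) (G : L2Vec Ω),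
      (∫ x in Ω, f x * fderiv ℝ φ x v = - ∫ x in Ω, inner ℝ (G x) v * φ x) ↔
        inner ℝ a f + inner ℝ b G = 0 := by
  have h1 : Continuous fun x => fderiv ℝ φ x v :=
    (hφ.continuous_fderiv (by simp)).clm_apply continuous_const
  have h2 : Continuous fun x => φ x • v := hφ.continuous.smul continuous_const
  obtain ⟨a, ha⟩ : ∃ a : L2 Ω, a =ᵐ[volume.restrict Ω] fun x => fderiv ℝ φ x v :=
    ⟨(memLp_two_of_continuous hΩb h1).toLp _, MemLp.coeFn_toLp _⟩
  obtain ⟨b, hb⟩ : ∃ b : L2Vec Ω, b =ᵐ[volume.restrict Ω] fun x => φ x • v :=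
    ⟨(memLp_two_of_continuous hΩb h2).toLp _, MemLp.coeFn_toLp _⟩
  refine ⟨a, b, fun f G => ?_⟩
  rw [L2.inner_def, L2.inner_def]
  have e1 : ∫ x in Ω, inner ℝ (a x) (f x) = ∫ x in Ω, f x * fderiv ℝ φ x v := by
    refine integral_congr_ae ?_
    filter_upwards [ha] with x hx
    rw [hx]
    simp
  have e2 : ∫ x in Ω, inner ℝ (b x) (G x) = ∫ x in Ω, inner ℝ (G x) v * φ x := by
    refine integral_congr_ae ?_
    filter_upwards [hb] with x hx
    rw [hx, real_inner_comm, inner_smul_right, mul_comm]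
  rw [e1, e2, add_eq_zero_iff_eq_neg]

theorem continuous_gradient {φ : EuclideanSpace ℝ (Fin d) → ℝ} (hφ : ContDiff ℝ ∞ φ) :
    Continuous (gradient φ) :=
  (InnerProductSpace.toDual ℝ _).symm.continuous.comp (hφ.continuous_fderiv (by simp))

theorem gradient_add {φ ψ : EuclideanSpace ℝ (Fin d) → ℝ} (hφ : ContDiff ℝ ∞ φ)
    (hψ : ContDiff ℝ ∞ ψ) (x : EuclideanSpace ℝ (Fin d)) :
    gradient (φ + ψ) x = gradient φ x + gradient ψ x := by
  unfold gradient
  rw [fderiv_add (hφ.differentiable (by simp) x) (hψ.differentiable (by simp) x), map_add]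

theorem gradient_smul {φ : EuclideanSpace ℝ (Fin d) → ℝ} (hφ : ContDiff ℝ ∞ φ) (c : ℝ)
    (x : EuclideanSpace ℝ (Fin d)) : gradient (c • φ) x = c • gradient φ x := by
  unfold gradient
  rw [fderiv_const_smul (hφ.differentiable (by simp) x), map_smul]

theorem IsTestFunction.add {φ ψ : EuclideanSpace ℝ (Fin d) → ℝ} (hφ : IsTestFunction Ω φ)
    (hψ : IsTestFunction Ω ψ) : IsTestFunction Ω (φ + ψ) :=
  ⟨hφ.1.add hψ.1, hφ.2.1.add hψ.2.1,
    (tsupport_add φ ψ).trans (union_subset hφ.2.2 hψ.2.2)⟩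

theorem IsTestFunction.smul {φ : EuclideanSpace ℝ (Fin d) → ℝ} (hφ : IsTestFunction Ω φ)
    (c : ℝ) : IsTestFunction Ω (c • φ) :=
  ⟨hφ.1.const_smul c, hφ.2.1.smul_left (f := fun _ => c),
    (tsupport_smul_subset_right (fun _ => c) φ).trans hφ.2.2⟩

theorem integratesByParts_add (hΩb : Bornology.IsBounded Ω)
    {φ : EuclideanSpace ℝ (Fin d) → ℝ} (hφ : ContDiff ℝ ∞ φ) {f f' : L2 Ω} {G G' : L2Vec Ω}
    (h : IntegratesByParts Ω f G φ) (h' : IntegratesByParts Ω f' G' φ) :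
    IntegratesByParts Ω (f + f') (G + G') φ := by
  intro v
  obtain ⟨a, b, hab⟩ := exists_integratesByParts_iff hΩb hφ v
  have h1 := (hab _ _).1 (h v)
  have h2 := (hab _ _).1 (h' v)
  rw [hab, inner_add_right, inner_add_right]
  linarith

theorem integratesByParts_smul (hΩb : Bornology.IsBounded Ω)
    {φ : EuclideanSpace ℝ (Fin d) → ℝ} (hφ : ContDiff ℝ ∞ φ) {f : L2 Ω} {G : L2Vec Ω}
    (h : IntegratesByParts Ω f G φ) (c : ℝ) : IntegratesByParts Ω (c • f) (c • G) φ := by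
  intro v
  obtain ⟨a, b, hab⟩ := exists_integratesByParts_iff hΩb hφ v
  have h1 := (hab _ _).1 (h v)
  rw [hab, inner_smul_right, inner_smul_right, ← mul_add, h1, mul_zero]

theorem isClosed_integratesByParts (hΩb : Bornology.IsBounded Ω)
    {φ : EuclideanSpace ℝ (Fin d) → ℝ} (hφ : ContDiff ℝ ∞ φ) :
    IsClosed {p : L2 Ω × L2Vec Ω | IntegratesByParts Ω p.1 p.2 φ} := by
  have : {p : L2 Ω × L2Vec Ω | IntegratesByParts Ω p.1 p.2 φ}
      = ⋂ v, {p : L2 Ω × L2Vec Ω | ∫ x in Ω, p.1 x * fderiv ℝ φ x v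
        = - ∫ x in Ω, inner ℝ (p.2 x) v * φ x} := by
    ext p
    simp [IntegratesByParts]
  rw [this]
  refine isClosed_iInter fun v => ?_
  obtain ⟨a, b, hab⟩ := exists_integratesByParts_iff hΩb hφ v
  simp_rw [hab]
  exact isClosed_eq (by fun_prop) continuous_const

variable {bc : BoundaryCondition d}

theorem eLpNorm_sub_add_lt {F : Type*} [NormedAddCommGroup F]
    {μ : Measure (EuclideanSpace ℝ (Fin d))} {a b g : EuclideanSpace ℝ (Fin d) → F} {η : ℝ≥0∞}
    (ha : AEStronglyMeasurable a μ) (hb : AEStronglyMeasurable b μ) (hg : g =ᵐ[μ] a + b)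
    (h1 : eLpNorm a 2 μ < η / 2) (h2 : eLpNorm b 2 μ < η / 2) : eLpNorm g 2 μ < η := by
  rw [eLpNorm_congr_ae hg]
  refine (eLpNorm_add_le ha hb (by norm_num)).trans_lt ?_
  rw [← ENNReal.add_halves η]
  exact ENNReal.add_lt_add h1 h2

theorem MemH1.add (hΩb : Bornology.IsBounded Ω) {f f' : L2 Ω} {G G' : L2Vec Ω}
    (h : MemH1 bc Ω f G) (h' : MemH1 bc Ω f' G') : MemH1 bc Ω (f + f') (G + G') := by
  cases bc with
  | dirichlet =>
    intro η hη
    obtain ⟨φ, hφ, h1, h2⟩ := h (η / 2) (ENNReal.half_pos hη.ne')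
    obtain ⟨ψ, hψ, h3, h4⟩ := h' (η / 2) (ENNReal.half_pos hη.ne')
    refine ⟨φ + ψ, hφ.add hψ, eLpNorm_sub_add_lt ?_ ?_ ?_ h1 h3,
      eLpNorm_sub_add_lt ?_ ?_ ?_ h2 h4⟩
    · exact (Lp.aestronglyMeasurable f).sub hφ.1.continuous.aestronglyMeasurable
    · exact (Lp.aestronglyMeasurable f').sub hψ.1.continuous.aestronglyMeasurable
    · filter_upwards [Lp.coeFn_add f f'] with x hx
      simp only [hx, Pi.add_apply]
      abel
    · exact (Lp.aestronglyMeasurable G).sub (continuous_gradient hφ.1).aestronglyMeasurable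
    · exact (Lp.aestronglyMeasurable G').sub (continuous_gradient hψ.1).aestronglyMeasurable
    · filter_upwards [Lp.coeFn_add G G'] with x hx
      rw [gradient_add hφ.1 hψ.1]
      simp only [hx, Pi.add_apply]
      abel
  | neumann => exact fun φ hφ => integratesByParts_add hΩb hφ.1 (h φ hφ) (h' φ hφ)
  | periodic a b => exact fun φ hφ => integratesByParts_add hΩb hφ.1 (h φ hφ) (h' φ hφ)

theorem MemH1.smul (hΩb : Bornology.IsBounded Ω) {f : L2 Ω} {G : L2Vec Ω}
    (h : MemH1 bc Ω f G) (c : ℝ) : MemH1 bc Ω (c • f) (c • G) := by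
  cases bc with
  | dirichlet =>
    intro η hη
    -- For `c = 0` the quotient is `⊤`, which is still an admissible tolerance.
    have hη' : 0 < η / ‖c‖ₑ := ENNReal.div_pos hη.ne' (by simp)
    obtain ⟨φ, hφ, h1, h2⟩ := h _ hη'
    refine ⟨c • φ, hφ.smul c, ?_, ?_⟩
    · have e : (fun x => (c • f) x - (c • φ) x) =ᵐ[volume.restrict Ω] c • fun x => f x - φ x := by
        filter_upwards [Lp.coeFn_smul c f] with x hx
        simp only [hx, Pi.smul_apply, smul_sub]
      rw [eLpNorm_congr_ae e, eLpNorm_const_smul]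
      exact ENNReal.mul_lt_of_lt_div' h1
    · have e : (fun x => (c • G) x - gradient (c • φ) x)
          =ᵐ[volume.restrict Ω] c • fun x => G x - gradient φ x := by
        filter_upwards [Lp.coeFn_smul c G] with x hx
        simp only [hx, gradient_smul hφ.1, Pi.smul_apply, smul_sub]
      rw [eLpNorm_congr_ae e, eLpNorm_const_smul]
      exact ENNReal.mul_lt_of_lt_div' h2
  | neumann => exact fun φ hφ => integratesByParts_smul hΩb hφ.1 (h φ hφ) c
  | periodic a b => exact fun φ hφ => integratesByParts_smul hΩb hφ.1 (h φ hφ) c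

theorem MemH1.sub (hΩb : Bornology.IsBounded Ω) {f f' : L2 Ω} {G G' : L2Vec Ω}
    (h : MemH1 bc Ω f G) (h' : MemH1 bc Ω f' G') : MemH1 bc Ω (f - f') (G - G') := by
  have := h.add hΩb (h'.smul hΩb (-1))
  simpa [sub_eq_add_neg] using this

theorem memH1_zero : MemH1 bc Ω 0 0 := by
  cases bc with
  | dirichlet =>
    intro η hη
    refine ⟨0, ⟨contDiff_const, HasCompactSupport.zero, by simp⟩, ?_, ?_⟩
    · refine lt_of_eq_of_lt (eLpNorm_eq_zero_of_ae_zero ?_) hη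
      filter_upwards [Lp.coeFn_zero ℝ 2 (volume.restrict Ω)] with x hx
      simp only [hx]
      simp
    · refine lt_of_eq_of_lt (eLpNorm_eq_zero_of_ae_zero ?_) hη
      filter_upwards [Lp.coeFn_zero (EuclideanSpace ℝ (Fin d)) 2 (volume.restrict Ω)] with x hx
      simp only [hx]
      simp [gradient]
  | neumann =>
    intro φ _ v
    rw [integral_eq_zero_of_ae, integral_eq_zero_of_ae, neg_zero]
    · filter_upwards [Lp.coeFn_zero (EuclideanSpace ℝ (Fin d)) 2 (volume.restrict Ω)] with x hx
      simp only [hx]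
      simp
    · filter_upwards [Lp.coeFn_zero ℝ 2 (volume.restrict Ω)] with x hx
      simp only [hx]
      simp
  | periodic a b =>
    intro φ _ v
    rw [integral_eq_zero_of_ae, integral_eq_zero_of_ae, neg_zero]
    · filter_upwards [Lp.coeFn_zero (EuclideanSpace ℝ (Fin d)) 2 (volume.restrict Ω)] with x hx
      simp only [hx]
      simp
    · filter_upwards [Lp.coeFn_zero ℝ 2 (volume.restrict Ω)] with x hx
      simp only [hx]
      simp

theorem isClosed_memH1 (hΩb : Bornology.IsBounded Ω) :
    IsClosed {p : L2 Ω × L2Vec Ω | MemH1 bc Ω p.1 p.2} := by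
  cases bc with
  | dirichlet =>
    rw [← isSeqClosed_iff_isClosed]
    intro p p₀ hp hlim η hη
    have hl1 := (Lp.tendsto_Lp_iff_tendsto_eLpNorm' _ _).1 ((continuous_fst.tendsto _).comp hlim)
    have hl2 := (Lp.tendsto_Lp_iff_tendsto_eLpNorm' _ _).1 ((continuous_snd.tendsto _).comp hlim)
    have hη2 := ENNReal.half_pos hη.ne'
    obtain ⟨n, hn1, hn2⟩ := ((hl1.eventually_lt_const hη2).and (hl2.eventually_lt_const hη2)).exists
    obtain ⟨φ, hφ, h1, h2⟩ := hp n (η / 2) hη2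
    simp only [Function.comp_apply] at hn1 hn2
    rw [← eLpNorm_neg] at hn1 hn2
    refine ⟨φ, hφ, eLpNorm_sub_add_lt ?_ ?_ ?_ hn1 h1, eLpNorm_sub_add_lt ?_ ?_ ?_ hn2 h2⟩
    · exact ((Lp.aestronglyMeasurable _).sub (Lp.aestronglyMeasurable _)).neg
    · exact (Lp.aestronglyMeasurable _).sub hφ.1.continuous.aestronglyMeasurable
    · refine Eventually.of_forall fun x => ?_
      simp
    · exact ((Lp.aestronglyMeasurable _).sub (Lp.aestronglyMeasurable _)).neg
    · exact (Lp.aestronglyMeasurable _).sub (continuous_gradient hφ.1).aestronglyMeasurable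
    · refine Eventually.of_forall fun x => ?_
      simp
  | neumann =>
    have : {p : L2 Ω × L2Vec Ω | MemH1 .neumann Ω p.1 p.2} = ⋂ φ, ⋂ (_ : IsTestFunction Ω φ),
        {p : L2 Ω × L2Vec Ω | IntegratesByParts Ω p.1 p.2 φ} := by
      ext p
      simp [MemH1]
    rw [this]
    exact isClosed_biInter fun φ hφ => isClosed_integratesByParts hΩb hφ.1
  | periodic a b =>
    have : {p : L2 Ω × L2Vec Ω | MemH1 (.periodic a b) Ω p.1 p.2} =
        ⋂ φ, ⋂ (_ : IsPeriodicTestFunction a b φ),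
          {p : L2 Ω × L2Vec Ω | IntegratesByParts Ω p.1 p.2 φ} := by
      ext p
      simp [MemH1]
    rw [this]
    exact isClosed_biInter fun φ hφ => isClosed_integratesByParts hΩb hφ.1

end EnergySpace

/-! ### The resolvent `(m² - Δ)⁻¹` by orthogonal projection -/

section Resolvent

variable {d : ℕ} {Ω : Set (EuclideanSpace ℝ (Fin d))}

/-- The resolvent `x ↦ (r x, q x)` with `(m² - Δ) (r x) = x` and `q x = ∇ (r x)`. -/
theorem exists_resolvent (hΩb : Bornology.IsBounded Ω) (bc : BoundaryCondition d) {m : ℝ}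
    (hm : 0 < m) : ∃ (r : L2 Ω →L[ℝ] L2 Ω) (q : L2 Ω →L[ℝ] L2Vec Ω), ∀ x,
      MemH1 bc Ω (r x) (q x) ∧ ∀ φ Gφ, MemH1 bc Ω φ Gφ →
        m ^ 2 * inner ℝ (r x) φ + inner ℝ (q x) Gφ = inner ℝ x φ := by
  -- `W` consists of the pairs `(m φ, ∇φ)`, so its Hilbert norm encodes the form `m² ⟨φ, ψ⟩ + ⟨∇φ,
  -- ∇ψ⟩`.
  let W : Submodule ℝ (WithLp 2 (L2 Ω × L2Vec Ω)) :=
    { carrier := {p | MemH1 bc Ω (m⁻¹ • p.fst) p.snd}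
      add_mem' := fun {p p'} h h' => by
        have := MemH1.add hΩb h h'
        simpa [smul_add] using this
      zero_mem' := by simpa using memH1_zero
      smul_mem' := fun c p h => by
        have := MemH1.smul hΩb h c
        rw [smul_comm] at this
        exact this }
  have hW : IsClosed (W : Set (WithLp 2 (L2 Ω × L2Vec Ω))) := by
    have hc : Continuous fun p : WithLp 2 (L2 Ω × L2Vec Ω) => (m⁻¹ • p.fst, p.snd) := by fun_prop
    exact (isClosed_memH1 (bc := bc) hΩb).preimage hc
  have : CompleteSpace W := hW.completeSpace_coe
  let ι : L2 Ω →L[ℝ] WithLp 2 (L2 Ω × L2Vec Ω) :=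
    (WithLp.prodContinuousLinearEquiv 2 ℝ (L2 Ω) (L2Vec Ω)).symm.toContinuousLinearMap.comp
      (ContinuousLinearMap.inl ℝ (L2 Ω) (L2Vec Ω))
  -- Projecting `(m⁻¹ x, 0)` onto `W` gives `(m φ, ∇φ)`; orthogonality of the residual to `W` is the
  -- weak equation for `φ`.
  let J : L2 Ω →L[ℝ] WithLp 2 (L2 Ω × L2Vec Ω) := W.starProjection.comp (m⁻¹ • ι)
  refine ⟨m⁻¹ • (WithLp.fstL 2 ℝ (L2 Ω) (L2Vec Ω)).comp J,
    (WithLp.sndL 2 ℝ (L2 Ω) (L2Vec Ω)).comp J, fun x => ⟨?_, ?_⟩⟩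
  · exact W.starProjection_apply_mem _
  · intro φ Gφ hφ
    have hmem : WithLp.toLp 2 (m • φ, Gφ) ∈ W := by
      change MemH1 bc Ω (m⁻¹ • (m • φ)) Gφ
      rwa [inv_smul_smul₀ hm.ne']
    have h1 : inner ℝ ((m⁻¹ • ι) x - J x) (WithLp.toLp 2 (m • φ, Gφ)) = 0 :=
      W.starProjection_inner_eq_zero _ _ hmem
    rw [inner_sub_left, WithLp.prod_inner_apply, WithLp.prod_inner_apply] at h1
    have e1 : ((m⁻¹ • ι) x).ofLp = (m⁻¹ • x, m⁻¹ • (0 : L2Vec Ω)) := rfl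
    rw [e1] at h1
    change m ^ 2 * inner ℝ (m⁻¹ • (J x).ofLp.1) φ + inner ℝ (J x).ofLp.2 Gφ = _
    simp only [inner_smul_left, inner_smul_right, smul_zero, inner_zero_left, add_zero,
      RCLike.conj_to_real] at h1 ⊢
    field_simp at h1 ⊢
    linarith

end Resolvent

/-! ### The regularized `H⁻¹` norm -/

section Lift

variable {d : ℕ} {Ω : Set (EuclideanSpace ℝ (Fin d))}

/-- `r = (m² - Δ)⁻¹` and `q = ∇ r`, under the boundary condition `bc`. -/
structure IsResolvent (bc : BoundaryCondition d) (Ω : Set (EuclideanSpace ℝ (Fin d))) (m : ℝ)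
    (r : L2 Ω →L[ℝ] L2 Ω) (q : L2 Ω →L[ℝ] L2Vec Ω) : Prop where
  pos : 0 < m
  memH1 : ∀ x, MemH1 bc Ω (r x) (q x)
  weak : ∀ x φ Gφ, MemH1 bc Ω φ Gφ → m ^ 2 * inner ℝ (r x) φ + inner ℝ (q x) Gφ = inner ℝ x φ

/-- The map `x ↦ (m r x, q x)`, whose norm is a regularized `H⁻¹` norm. -/
def resolventLift (m : ℝ) (r : L2 Ω →L[ℝ] L2 Ω) (q : L2 Ω →L[ℝ] L2Vec Ω) :
    L2 Ω →L[ℝ] WithLp 2 (L2 Ω × L2Vec Ω) :=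
  (WithLp.prodContinuousLinearEquiv 2 ℝ (L2 Ω) (L2Vec Ω)).symm.toContinuousLinearMap.comp
    ((m • r).prod q)

theorem inner_resolventLift_eq_add (m : ℝ) (r : L2 Ω →L[ℝ] L2 Ω) (q : L2 Ω →L[ℝ] L2Vec Ω)
    (x z : L2 Ω) : inner ℝ (resolventLift m r q x) (resolventLift m r q z)
      = m ^ 2 * inner ℝ (r x) (r z) + inner ℝ (q x) (q z) := by
  have h : inner ℝ (resolventLift m r q x) (resolventLift m r q z)
      = inner ℝ (m • r x) (m • r z) + inner ℝ (q x) (q z) := WithLp.prod_inner_apply _ _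
  rw [h, inner_smul_left, inner_smul_right, RCLike.conj_to_real]
  ring

namespace IsResolvent

variable {bc : BoundaryCondition d} {m : ℝ} {r : L2 Ω →L[ℝ] L2 Ω} {q : L2 Ω →L[ℝ] L2Vec Ω}

theorem inner_lift (h : IsResolvent bc Ω m r q) (x z : L2 Ω) :
    inner ℝ (resolventLift m r q x) (resolventLift m r q z) = inner ℝ x (r z) := by
  rw [inner_resolventLift_eq_add, h.weak x _ _ (h.memH1 z)]

theorem norm_sq_lift (h : IsResolvent bc Ω m r q) (x : L2 Ω) :
    ‖resolventLift m r q x‖ ^ 2 = inner ℝ x (r x) := by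
  rw [← real_inner_self_eq_norm_sq, h.inner_lift]

theorem norm_sq_lift_eq_add (x : L2 Ω) :
    ‖resolventLift m r q x‖ ^ 2 = m ^ 2 * ‖r x‖ ^ 2 + ‖q x‖ ^ 2 := by
  rw [← real_inner_self_eq_norm_sq, inner_resolventLift_eq_add, real_inner_self_eq_norm_sq,
    real_inner_self_eq_norm_sq]

theorem sq_mul_norm_le (h : IsResolvent bc Ω m r q) (x : L2 Ω) : m ^ 2 * ‖r x‖ ≤ ‖x‖ := by
  have h1 := norm_sq_lift_eq_add (m := m) (r := r) (q := q) x
  rw [h.norm_sq_lift] at h1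
  have h2 := real_inner_le_norm x (r x)
  rcases (norm_nonneg (r x)).eq_or_lt with h0 | h0
  · rw [← h0]
    simp
  · refine le_of_mul_le_mul_right ?_ h0
    nlinarith [sq_nonneg ‖q x‖]

variable {x Ψ : L2 Ω} {g : L2Vec Ω}

/-- The squared norm equals `⟨x, r x⟩ = ⟨g, q x⟩`, and `‖q x‖` is at most the lifted norm; cancel
one factor after Cauchy–Schwarz. This domination by the true `H⁻¹` norm is uniform in `m`. -/
theorem norm_lift_le (h : IsResolvent bc Ω m r q)
    (hg : ∀ φ Gφ, MemH1 bc Ω φ Gφ → inner ℝ g Gφ = inner ℝ x φ) :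
    ‖resolventLift m r q x‖ ≤ ‖g‖ := by
  have h1 := norm_sq_lift_eq_add (m := m) (r := r) (q := q) x
  have h2 : ‖q x‖ ≤ ‖resolventLift m r q x‖ := by
    refine abs_le_of_sq_le_sq' ?_ (norm_nonneg _) |>.2
    have : 0 ≤ m ^ 2 * ‖r x‖ ^ 2 := by positivity
    linarith
  have h3 := h.norm_sq_lift x
  rw [← hg _ _ (h.memH1 x)] at h3
  have h4 := real_inner_le_norm g (q x)
  rcases (norm_nonneg (resolventLift m r q x)).eq_or_lt with h0 | h0
  · rw [← h0]
    exact norm_nonneg _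
  · refine le_of_mul_le_mul_right ?_ h0
    nlinarith [norm_nonneg g]

theorem mul_norm_le (h : IsResolvent bc Ω m r q)
    (hg : ∀ φ Gφ, MemH1 bc Ω φ Gφ → inner ℝ g Gφ = inner ℝ x φ) : m * ‖r x‖ ≤ ‖g‖ := by
  refine le_trans ?_ (h.norm_lift_le hg)
  refine abs_le_of_sq_le_sq' ?_ (norm_nonneg _) |>.2
  rw [norm_sq_lift_eq_add, mul_pow]
  linarith [sq_nonneg ‖q x‖]

/-- Testing the resolvent equation with `Ψ` shows that the difference is exactly `-m² ⟨r x, Ψ⟩`, and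
`m ‖r x‖ ≤ ‖g‖` leaves one spare factor `m`. -/
theorem abs_norm_sq_lift_sub_le (h : IsResolvent bc Ω m r q) (hΨ : MemH1 bc Ω Ψ g)
    (hg : ∀ φ Gφ, MemH1 bc Ω φ Gφ → inner ℝ g Gφ = inner ℝ x φ) :
    |‖resolventLift m r q x‖ ^ 2 - ‖g‖ ^ 2| ≤ m * (‖g‖ * ‖Ψ‖) := by
  have h1 := h.weak x _ _ hΨ
  rw [← hg _ _ hΨ, real_inner_self_eq_norm_sq] at h1
  have h2 := h.norm_sq_lift x
  rw [← hg _ _ (h.memH1 x), real_inner_comm] at h2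
  have h3 : ‖resolventLift m r q x‖ ^ 2 - ‖g‖ ^ 2 = -(m ^ 2 * inner ℝ (r x) Ψ) := by linarith
  rw [h3, abs_neg, abs_mul, abs_of_nonneg (sq_nonneg m)]
  have hm := h.pos
  calc m ^ 2 * |inner ℝ (r x) Ψ| ≤ m ^ 2 * (‖r x‖ * ‖Ψ‖) := by
        gcongr; exact abs_real_inner_le_norm _ _
    _ = m * ((m * ‖r x‖) * ‖Ψ‖) := by ring
    _ ≤ m * (‖g‖ * ‖Ψ‖) := by
        gcongr; exact h.mul_norm_le hg

end IsResolvent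

end Lift

/-! ### Pointwise inequalities for the double well -/

section Energy

variable {d : ℕ} {Ω : Set (EuclideanSpace ℝ (Fin d))}

theorem exists_doubleWell_deriv {f : L2 Ω} (hf : MemLp f 6 (volume.restrict Ω)) :
    ∃ p : L2 Ω, p =ᵐ[volume.restrict Ω] fun x => f x ^ 3 - f x := by
  have h3 : MemLp (fun x => f x ^ 3) 2 (volume.restrict Ω) := by
    refine (memLp_two_iff_integrable_sq ((Lp.aestronglyMeasurable f).pow 3)).2 ?_
    have := hf.integrable_norm_pow (p := 6) (by norm_num)
    refine this.congr (Eventually.of_forall fun x => ?_)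
    simp only [Real.norm_eq_abs, Pi.pow_apply]
    rw [← pow_mul, Even.pow_abs (by decide)]
  have h := h3.sub (Lp.memLp f)
  exact ⟨h.toLp _, h.coeFn_toLp⟩

theorem integral_mul_eq_inner (p f : L2 Ω) : ∫ x in Ω, p x * f x = inner ℝ p f := by
  rw [L2.inner_def]
  simp [mul_comm]

theorem integrable_mul_L2 (p f : L2 Ω) : Integrable (fun x => p x * f x) (volume.restrict Ω) := by
  have := L2.integrable_inner (𝕜 := ℝ) p f
  simpa [mul_comm] using this

variable {f f' p p' : L2 Ω} {G G' : L2Vec Ω}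

/-- With `p = F'(f)`, one has `F(f) = (p f - f² + 1) / 4`, a combination of products of `L²`
functions. -/
theorem integrable_doubleWell (hΩb : Bornology.IsBounded Ω)
    (hp : p =ᵐ[volume.restrict Ω] fun x => f x ^ 3 - f x) :
    Integrable (fun x => doubleWell (f x)) (volume.restrict Ω) := by
  have : IsFiniteMeasure (volume.restrict Ω) :=
    ⟨by rw [Measure.restrict_apply_univ]; exact hΩb.measure_lt_top⟩
  have h := (((integrable_mul_L2 p f).sub (integrable_mul_L2 f f)).add
    (integrable_const (1 : ℝ))).div_const 4
  refine h.congr ?_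
  filter_upwards [hp] with x hx
  simp only [Pi.add_apply, Pi.sub_apply, hx, doubleWell]
  ring

theorem energy_eq (hΩb : Bornology.IsBounded Ω)
    (hp : p =ᵐ[volume.restrict Ω] fun x => f x ^ 3 - f x) (ε : ℝ) :
    energy Ω ε f G = ε ^ 2 / 2 * ‖G‖ ^ 2 + ∫ x in Ω, doubleWell (f x) := by
  have h := L2.integrable_inner (𝕜 := ℝ) G G
  have e := L2.inner_def (𝕜 := ℝ) G G
  simp only [real_inner_self_eq_norm_sq] at h e
  rw [energy, integral_add (h.const_mul _) (integrable_doubleWell hΩb hp), integral_const_mul, e]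

/-- Semiconvexity: `F'' ≥ -1` gives `F(a) ≤ F(b) - F'(a)(b - a) + (b - a)² / 2`. -/
theorem energy_le (hΩb : Bornology.IsBounded Ω)
    (hp : p =ᵐ[volume.restrict Ω] fun x => f x ^ 3 - f x)
    (hp' : p' =ᵐ[volume.restrict Ω] fun x => f' x ^ 3 - f' x) (ε : ℝ) :
    energy Ω ε f G ≤ energy Ω ε f' G' + (ε ^ 2 / 2 * (‖G‖ ^ 2 - ‖G'‖ ^ 2)
      - inner ℝ p (f' - f) + ‖f' - f‖ ^ 2 / 2) := by
  rw [energy_eq hΩb hp, energy_eq hΩb hp', ← real_inner_self_eq_norm_sq (f' - f),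
    ← integral_mul_eq_inner, ← integral_mul_eq_inner]
  have i1 := integrable_doubleWell hΩb hp'
  have i2 := integrable_mul_L2 p (f' - f)
  have i3 := integrable_mul_L2 (f' - f) (f' - f)
  have : ∫ x in Ω, doubleWell (f x) ≤ ∫ x in Ω, (doubleWell (f' x) - p x * (f' - f) x
      + (f' - f) x * (f' - f) x / 2) := by
    refine integral_mono_ae (integrable_doubleWell hΩb hp) ((i1.sub i2).add (i3.div_const 2)) ?_
    filter_upwards [hp, Lp.coeFn_sub f' f] with x h1 h2
    simp only [h1, h2, Pi.sub_apply, doubleWell]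
    nlinarith [mul_nonneg (sq_nonneg (f' x - f x)) (add_nonneg (sq_nonneg (f x + f' x))
      (mul_nonneg zero_le_two (sq_nonneg (f x))))]
  have i4 : Integrable (fun x => doubleWell (f' x) - p x * (f' - f) x) (volume.restrict Ω) :=
    i1.sub i2
  rw [integral_add i4 (i3.div_const 2), integral_sub i1 i2, integral_div] at this
  linarith

/-- The trapezoidal error for `F` is `-(a-b)²(a²-b²)/4`. It is controlled by `(a-b)²(a²+ab+b²)/2`,
which is half of `(F'(a)-F'(b))(a-b) + (a-b)²`; the error is thus bounded through `F'` itself. -/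
theorem abs_integral_doubleWell_sub_le (hΩb : Bornology.IsBounded Ω)
    (hp : p =ᵐ[volume.restrict Ω] fun x => f x ^ 3 - f x)
    (hp' : p' =ᵐ[volume.restrict Ω] fun x => f' x ^ 3 - f' x) :
    |(∫ x in Ω, doubleWell (f' x)) - (∫ x in Ω, doubleWell (f x))
      - inner ℝ (p' + p) (f' - f) / 2| ≤ (inner ℝ (p' - p) (f' - f) + ‖f' - f‖ ^ 2) / 2 := by
  rw [← real_inner_self_eq_norm_sq (f' - f), ← inner_add_left, ← integral_mul_eq_inner,
    ← integral_mul_eq_inner]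
  have i1 := integrable_doubleWell hΩb hp
  have i1' := integrable_doubleWell hΩb hp'
  have i2 := integrable_mul_L2 (p' + p) (f' - f)
  have i3 := integrable_mul_L2 (p' - p + (f' - f)) (f' - f)
  have i4 : Integrable (fun x => doubleWell (f' x) - doubleWell (f x)) (volume.restrict Ω) :=
    i1'.sub i1
  rw [← integral_div, ← integral_div, ← integral_sub i1' i1, ← integral_sub i4 (i2.div_const 2), ← Real.norm_eq_abs]
  refine norm_integral_le_of_norm_le (i3.div_const 2) ?_
  filter_upwards [hp, hp', Lp.coeFn_sub f' f, Lp.coeFn_add p' p,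
    Lp.coeFn_add (p' - p) (f' - f), Lp.coeFn_sub p' p] with x h1 h2 h3 h4 h5 h6
  simp only [h3, h4, h5, h6, Pi.add_apply, Pi.sub_apply, h1, h2, doubleWell]
  set a := f' x
  set b := f x
  have e : (a ^ 2 - 1) ^ 2 / 4 - (b ^ 2 - 1) ^ 2 / 4 - (a ^ 3 - a + (b ^ 3 - b)) * (a - b) / 2
      = -((a - b) ^ 2 * (a ^ 2 - b ^ 2)) / 4 := by ring
  rw [e, Real.norm_eq_abs, abs_le]
  constructor <;> nlinarith [mul_nonneg (sq_nonneg (a - b)) (sq_nonneg (a + b)),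
    mul_nonneg (sq_nonneg (a - b)) (sq_nonneg a), mul_nonneg (sq_nonneg (a - b)) (sq_nonneg b)]

end Energy

/-! ### Differentiability of the energy along a solution -/

namespace IsSolution

variable {d : ℕ} {Ω : Set (EuclideanSpace ℝ (Fin d))} {bc : BoundaryCondition d}
  {α γ ε T : ℝ} {u : ℝ → L2 Ω} {gu : ℝ → L2Vec Ω} {w : ℝ → L2 Ω} {gw : ℝ → L2Vec Ω}

theorem inner_potential (hu : IsSolution bc Ω α γ ε T u gu w gw) {t : ℝ} (ht : t ∈ Ioo 0 T)
    {p : L2 Ω} (hp : p =ᵐ[volume.restrict Ω] fun x => u t x ^ 3 - u t x) {φ : L2 Ω} {Gφ : L2Vec Ω}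
    (hφ : MemH1 bc Ω φ Gφ) : inner ℝ (w t) φ = ε ^ 2 * inner ℝ (gu t) Gφ + inner ℝ p φ := by
  rw [hu.potential t ht φ Gφ hφ, ← integral_mul_eq_inner]
  congr 1
  refine integral_congr_ae ?_
  filter_upwards [hp] with x hx
  rw [hx]

/-- The trapezoidal rule is exact for the quadratic gradient term, so with the double well estimate
the increment of `E` becomes the mean of `w` paired with the increment of `u`. In the error, the
difference of `F'(u)` is traded for that of `w` minus a nonnegative gradient term, leaving only `L²`
quantities. -/
theorem abs_energy_sub_le (hΩb : Bornology.IsBounded Ω)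
    (hu : IsSolution bc Ω α γ ε T u gu w gw) {s t : ℝ} (hs : s ∈ Ioo 0 T) (ht : t ∈ Ioo 0 T) :
    |energy Ω ε (u s) (gu s) - energy Ω ε (u t) (gu t) - inner ℝ (w s + w t) (u s - u t) / 2|
      ≤ (‖w s - w t‖ + ‖u s - u t‖) * ‖u s - u t‖ / 2 := by
  obtain ⟨p, hp⟩ := exists_doubleWell_deriv (hu.memL6 t (Ioo_subset_Icc_self ht))
  obtain ⟨p', hp'⟩ := exists_doubleWell_deriv (hu.memL6 s (Ioo_subset_Icc_self hs))
  have hd := (hu.memH1 s (Ioo_subset_Icc_self hs)).sub hΩb (hu.memH1 t (Ioo_subset_Icc_self ht))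
  have h1 := hu.inner_potential ht hp hd
  have h2 := hu.inner_potential hs hp' hd
  have h3 := abs_integral_doubleWell_sub_le hΩb hp hp'
  rw [energy_eq hΩb hp, energy_eq hΩb hp']
  have e1 : inner ℝ (gu s) (gu s - gu t) + inner ℝ (gu t) (gu s - gu t)
      = ‖gu s‖ ^ 2 - ‖gu t‖ ^ 2 := by
    simp only [inner_sub_right, real_inner_self_eq_norm_sq, real_inner_comm (gu s) (gu t)]
    ring
  have e2 : inner ℝ (gu s) (gu s - gu t) - inner ℝ (gu t) (gu s - gu t)
      = ‖gu s - gu t‖ ^ 2 := by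
    rw [← inner_sub_left, real_inner_self_eq_norm_sq]
  have h4 := real_inner_le_norm (w s - w t) (u s - u t)
  simp only [inner_add_left] at h3 ⊢
  rw [inner_sub_left] at h3 h4
  have h5 : 0 ≤ ε ^ 2 * ‖gu s - gu t‖ ^ 2 := by positivity
  have e3 : ε ^ 2 * (inner ℝ (gu s) (gu s - gu t) + inner ℝ (gu t) (gu s - gu t))
      = ε ^ 2 * (‖gu s‖ ^ 2 - ‖gu t‖ ^ 2) := by rw [e1]
  have e4 : ε ^ 2 * (inner ℝ (gu s) (gu s - gu t) - inner ℝ (gu t) (gu s - gu t))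
      = ε ^ 2 * ‖gu s - gu t‖ ^ 2 := by rw [e2]
  rw [abs_le] at h3 ⊢
  constructor <;> nlinarith [h3.1, h3.2]

theorem hasDerivAt_energy (hΩb : Bornology.IsBounded Ω)
    (hu : IsSolution bc Ω α γ ε T u gu w gw) {t : ℝ} (ht : t ∈ Ioo 0 T) :
    HasDerivAt (fun s => energy Ω ε (u s) (gu s)) (inner ℝ (w t) (deriv u t)) t := by
  have hnhds : Icc 0 T ∈ 𝓝 t := Icc_mem_nhds ht.1 ht.2
  have hud := (hu.differentiableAt t ht).hasDerivAt
  have hw : Tendsto w (𝓝[≠] t) (𝓝 (w t)) :=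
    ((hu.continuousOn_potential.continuousAt hnhds).tendsto).mono_left nhdsWithin_le_nhds
  have huc : Tendsto u (𝓝[≠] t) (𝓝 (u t)) :=
    hud.continuousAt.tendsto.mono_left nhdsWithin_le_nhds
  have hsl := hasDerivAt_iff_tendsto_slope.1 hud
  rw [hasDerivAt_iff_tendsto_slope]
  have h1 : Tendsto (fun s => inner ℝ (w s + w t) (slope u t s) / 2) (𝓝[≠] t)
      (𝓝 (inner ℝ (w t) (deriv u t))) := by
    have := ((hw.add_const (w t)).inner hsl (𝕜 := ℝ)).div_const 2
    rw [inner_add_left, add_self_div_two] at this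
    exact this
  have h2 : Tendsto (fun s => (‖w s - w t‖ + ‖u s - u t‖) * ‖slope u t s‖ / 2) (𝓝[≠] t)
      (𝓝 0) := by
    have := ((((hw.sub_const (w t)).norm).add ((huc.sub_const (u t)).norm)).mul
      hsl.norm).div_const 2
    simpa using this
  have h3 : Tendsto (fun s => slope (fun s => energy Ω ε (u s) (gu s)) t s
      - inner ℝ (w s + w t) (slope u t s) / 2) (𝓝[≠] t) (𝓝 0) := by
    refine squeeze_zero_norm' ?_ h2
    filter_upwards [self_mem_nhdsWithin, nhdsWithin_le_nhds (Ioo_mem_nhds ht.1 ht.2)] with s hst hs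
    have hne : s - t ≠ 0 := sub_ne_zero.2 hst
    have key := hu.abs_energy_sub_le hΩb hs ht
    rw [slope_def_module, slope_def_module, inner_smul_right, norm_smul, norm_inv, smul_eq_mul,
      Real.norm_eq_abs, Real.norm_eq_abs]
    have hpos : 0 < |s - t|⁻¹ := by positivity
    have := mul_le_mul_of_nonneg_left key hpos.le
    rw [← abs_inv, ← abs_mul] at this
    calc _ = |(s - t)⁻¹ * (energy Ω ε (u s) (gu s) - energy Ω ε (u t) (gu t)
          - inner ℝ (w s + w t) (u s - u t) / 2)| := by congr 1; ring
      _ ≤ _ := this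
      _ = _ := by rw [abs_inv]; ring
  have h4 := h3.add h1
  simpa using h4

theorem continuousOn_inner_deriv (hu : IsSolution bc Ω α γ ε T u gu w gw) :
    ContinuousOn (fun t => inner ℝ (w t) (deriv u t)) (Ioo 0 T) :=
  (hu.continuousOn_potential.mono Ioo_subset_Icc_self).inner hu.continuousOn_deriv

theorem energy_sub_eq_integral (hΩb : Bornology.IsBounded Ω)
    (hu : IsSolution bc Ω α γ ε T u gu w gw) {s t : ℝ} (hs : 0 < s) (hst : s ≤ t) (ht : t < T) :
    energy Ω ε (u t) (gu t) - energy Ω ε (u s) (gu s)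
      = ∫ r in s..t, inner ℝ (w r) (deriv u r) := by
  have hsub : ∀ r ∈ uIcc s t, r ∈ Ioo 0 T := fun r hr => by
    rw [uIcc_of_le hst] at hr
    exact ⟨hs.trans_le hr.1, hr.2.trans_lt ht⟩
  exact (intervalIntegral.integral_eq_sub_of_hasDerivAt
    (fun r hr => hu.hasDerivAt_energy hΩb (hsub r hr))
    (hu.continuousOn_inner_deriv.mono hsub).intervalIntegrable).symm

/-- Lower semicontinuity in time of the energy. -/
theorem energy_le_add_of_tendsto (hΩb : Bornology.IsBounded Ω)
    (hu : IsSolution bc Ω α γ ε T u gu w gw) {t : ℝ} (ht : t ∈ Icc 0 T) :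
    ∃ e : ℝ → ℝ, Tendsto e (𝓝[Icc 0 T] t) (𝓝 0) ∧
      ∀ s ∈ Icc 0 T, energy Ω ε (u t) (gu t) ≤ energy Ω ε (u s) (gu s) + e s := by
  obtain ⟨p, hp⟩ := exists_doubleWell_deriv (hu.memL6 t ht)
  refine ⟨fun s => ε ^ 2 / 2 * (‖gu t‖ ^ 2 - ‖gu s‖ ^ 2) - inner ℝ p (u s - u t)
    + ‖u s - u t‖ ^ 2 / 2, ?_, fun s hs => ?_⟩
  · have h1 := hu.continuousOn t ht
    have h2 := hu.continuousOn_grad t ht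
    have h3 : ContinuousWithinAt (fun s => ε ^ 2 / 2 * (‖gu t‖ ^ 2 - ‖gu s‖ ^ 2)
        - inner ℝ p (u s - u t) + ‖u s - u t‖ ^ 2 / 2) (Icc 0 T) t := by fun_prop
    simpa [ContinuousWithinAt] using h3
  · obtain ⟨p', hp'⟩ := exists_doubleWell_deriv (hu.memL6 s hs)
    exact energy_le hΩb hp hp' ε

/-- Upper semicontinuity in time of the energy at the initial time. -/
theorem exists_energy_le_initial_add (hΩb : Bornology.IsBounded Ω) (hT : 0 < T)
    (hu : IsSolution bc Ω α γ ε T u gu w gw) :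
    ∃ e : ℝ → ℝ, Tendsto e (𝓝[>] 0) (𝓝 0) ∧
      ∀ s ∈ Ioo 0 T, energy Ω ε (u s) (gu s) ≤ energy Ω ε (u 0) (gu 0) + e s := by
  have h0 : (0 : ℝ) ∈ Icc 0 T := ⟨le_rfl, hT.le⟩
  refine ⟨fun s => ε ^ 2 / 2 * (‖gu s‖ ^ 2 - ‖gu 0‖ ^ 2)
    - (inner ℝ (w s) (u 0 - u s) - ε ^ 2 * inner ℝ (gu s) (gu 0 - gu s))
    + ‖u 0 - u s‖ ^ 2 / 2, ?_, fun s hs => ?_⟩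
  · have h1 := hu.continuousOn 0 h0
    have h2 := hu.continuousOn_grad 0 h0
    have h4 := hu.continuousOn_potential 0 h0
    have h3 : ContinuousWithinAt (fun s => ε ^ 2 / 2 * (‖gu s‖ ^ 2 - ‖gu 0‖ ^ 2)
        - (inner ℝ (w s) (u 0 - u s) - ε ^ 2 * inner ℝ (gu s) (gu 0 - gu s))
        + ‖u 0 - u s‖ ^ 2 / 2) (Icc 0 T) 0 := by
      have h7 := h4.inner (h1.const_sub (u 0)) (𝕜 := ℝ)
      have h8 := h2.inner (h2.const_sub (gu 0)) (𝕜 := ℝ)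
      exact ((((h2.norm.pow 2).sub continuousWithinAt_const).const_mul _).sub
        (h7.sub (h8.const_mul _))).add (((h1.const_sub (u 0)).norm.pow 2).div_const 2)
    have h5 : 𝓝[>] (0 : ℝ) ≤ 𝓝[Icc 0 T] 0 := by
      rw [nhdsWithin_le_iff]
      exact mem_of_superset (Ioo_mem_nhdsGT hT) Ioo_subset_Icc_self
    have h6 := h3.tendsto.mono_left h5
    simpa using h6
  · have hs' := Ioo_subset_Icc_self hs
    obtain ⟨p, hp⟩ := exists_doubleWell_deriv (hu.memL6 s hs')
    obtain ⟨p', hp'⟩ := exists_doubleWell_deriv (hu.memL6 0 h0)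
    have h1 := energy_le (G := gu s) (G' := gu 0) hΩb hp hp' ε
    -- The pairing with `F'(u(s))`, whose base point moves with `s`, is expressed through `w(s)` and
    -- the gradients, all continuous at zero.
    have h2 := hu.inner_potential hs hp ((hu.memH1 0 h0).sub hΩb (hu.memH1 s hs'))
    linarith

end IsSolution

/-! ### The energy inequality for a fixed resolvent parameter -/

section EnergyInequality

variable {d : ℕ} {Ω : Set (EuclideanSpace ℝ (Fin d))} {bc : BoundaryCondition d}

/-- The increment `u(t) - u(0)`, with `t` clamped to `[0,T]`. -/
def increment (T : ℝ) (u : ℝ → L2 Ω) (t : ℝ) : L2 Ω := u (max 0 (min T t)) - u 0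

theorem increment_eq {T : ℝ} (u : ℝ → L2 Ω) {t : ℝ} (ht : t ∈ Icc 0 T) :
    increment T u t = u t - u 0 := by
  rw [increment, min_eq_right ht.2, max_eq_right ht.1]

theorem potential_sub (hΩb : Bornology.IsBounded Ω) {T : ℝ} {u Ψ : ℝ → L2 Ω} {gΨ : ℝ → L2Vec Ω}
    (hΨ : ∀ t ∈ Icc 0 T, IsPotential bc Ω (u t - u 0) (Ψ t) (gΨ t)) {t τ : ℝ}
    (ht : t ∈ Icc 0 T) (hτ : τ ∈ Icc 0 T) :
    MemH1 bc Ω (Ψ t - Ψ τ) (gΨ t - gΨ τ) ∧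
      ∀ φ Gφ, MemH1 bc Ω φ Gφ → inner ℝ (gΨ t - gΨ τ) Gφ = inner ℝ (u t - u τ) φ := by
  refine ⟨(hΨ t ht).1.sub hΩb (hΨ τ hτ).1, fun φ Gφ hφ => ?_⟩
  rw [inner_sub_left, (hΨ t ht).2.1 φ Gφ hφ, (hΨ τ hτ).2.1 φ Gφ hφ, ← inner_sub_left]
  congr 1
  abel

section FixedResolvent

variable {α γ ε T : ℝ} {u : ℝ → L2 Ω} {gu : ℝ → L2Vec Ω} {w : ℝ → L2 Ω} {gw : ℝ → L2Vec Ω}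
  {Ψ : ℝ → L2 Ω} {gΨ : ℝ → L2Vec Ω}
  {m : ℝ} {r : L2 Ω →L[ℝ] L2 Ω} {q : L2 Ω →L[ℝ] L2Vec Ω}

theorem continuous_increment (hT : 0 < T) (hu : ContinuousOn u (Icc 0 T)) :
    Continuous (increment T u) :=
  (hu.comp_continuous (by fun_prop) fun t => ⟨le_max_left _ _,
    max_le hT.le (min_le_left _ _)⟩).sub continuous_const

theorem memoryPath_lift (hΩb : Bornology.IsBounded Ω) (hα0 : 0 < α) (hα1 : α < 1) (hT : 0 < T)
    (hu : IsSolution bc Ω α γ ε T u gu w gw)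
    (hΨ : ∀ t ∈ Icc 0 T, IsPotential bc Ω (u t - u 0) (Ψ t) (gΨ t))
    (hD : ∀ t ∈ Ioc 0 T, NonlocalTermWellDefined α gΨ t) (hr : IsResolvent bc Ω m r q) :
    MemoryPath α T (fun t => resolventLift m r q (increment T u t))
      (fun t => resolventLift m r q (deriv u t)) := by
  have hcont : Continuous fun t => resolventLift m r q (increment T u t) :=
    (resolventLift m r q).continuous.comp (continuous_increment hT hu.continuousOn)
  refine ⟨hα0, hα1, hcont, ?_, fun τ hτ => ?_, ?_, ?_, fun t ht => ?_⟩
  · simp [increment_eq u (left_mem_Icc.2 hT.le)]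
  · have h1 := ((hu.differentiableAt τ hτ).hasDerivAt.sub_const (u 0))
    have h2 : HasDerivAt (increment T u) (deriv u τ) τ := by
      refine h1.congr_of_eventuallyEq ?_
      filter_upwards [Ioo_mem_nhds hτ.1 hτ.2] with s hs
      exact increment_eq u (Ioo_subset_Icc_self hs)
    exact (resolventLift m r q).hasFDerivAt.comp_hasDerivAt τ h2
  · exact (resolventLift m r q).continuous.comp_continuousOn hu.continuousOn_deriv
  · exact (resolventLift m r q).integrable_comp hu.integrableOn_deriv
  · have htI : t ∈ Icc 0 T := Ioc_subset_Icc_self ht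
    refine Integrable.mono' (hD t ht) ?_ ?_
    · refine AEMeasurable.aestronglyMeasurable (Measurable.aemeasurable ?_)
      refine Measurable.div (Continuous.measurable (by fun_prop)) ?_
      exact (measurable_const.sub measurable_id).pow_const _
    · filter_upwards [ae_restrict_mem measurableSet_Ioo] with τ hτ
      have hτI : τ ∈ Icc 0 T := ⟨hτ.1.le, hτ.2.le.trans ht.2⟩
      have hp : 0 ≤ (t - τ) ^ (α + 1) := Real.rpow_nonneg (by linarith [hτ.2]) _
      rw [Real.norm_of_nonneg (div_nonneg (sq_nonneg _) hp), increment_eq u htI,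
        increment_eq u hτI, ← map_sub, sub_sub_sub_cancel_right]
      gcongr
      exact hr.norm_lift_le (potential_sub hΩb hΨ htI hτI).2

/-- Pulling the lift through the integral turns the left side into `Γ(1-α) ⟨∂ₜ^α u, r z⟩`. Testing
the evolution with `r z` produces `⟨∇w, q z⟩`, and the resolvent equation tested with `w` replaces
it by `⟨w, z⟩` minus the `m²` error. -/
theorem inner_lift_fracConv (hα0 : 0 < α) (hα1 : α < 1)
    (hu : IsSolution bc Ω α γ ε T u gu w gw) (hr : IsResolvent bc Ω m r q) {t : ℝ}
    (ht : t ∈ Ioo 0 T) (z : L2 Ω) :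
    inner ℝ (resolventLift m r q z) (fracConv α (fun t => resolventLift m r q (deriv u t)) t)
      = -(γ * Real.Gamma (1 - α)) * (inner ℝ (w t) z - m ^ 2 * inner ℝ (w t) (r z)) := by
  have hΓ : Real.Gamma (1 - α) ≠ 0 := (Real.Gamma_pos_of_pos (by linarith)).ne'
  have hi : IntegrableOn (fun τ => ((t - τ) ^ α)⁻¹ • deriv u τ) (Ioo 0 t) := by
    obtain ⟨B, hB⟩ := exists_bound_singular_integral hα0 hα1 hu.continuousOn_deriv
      hu.integrableOn_deriv ht.1 ht.2
    refine Integrable.mono' (hB t ⟨le_rfl, le_rfl⟩).1 ?_ ?_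
    · refine AEStronglyMeasurable.smul (f := fun τ => ((t - τ) ^ α)⁻¹) ?_
        (hu.integrableOn_deriv.mono_set (Ioo_subset_Ioo_right ht.2.le)).aestronglyMeasurable
      refine AEMeasurable.aestronglyMeasurable (Measurable.aemeasurable ?_)
      exact ((measurable_const.sub measurable_id).pow_const _).inv
    · filter_upwards [ae_restrict_mem measurableSet_Ioo] with τ hτ
      have h0 : 0 ≤ t - τ := by linarith [hτ.2]
      rw [norm_smul, Real.norm_of_nonneg (inv_nonneg.2 (Real.rpow_nonneg h0 _)),
        Real.rpow_neg h0]
  have h1 : fracConv α (fun t => resolventLift m r q (deriv u t)) t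
      = resolventLift m r q (Real.Gamma (1 - α) • caputo α u t) := by
    rw [caputo, smul_inv_smul₀ hΓ, ← ContinuousLinearMap.integral_comp_comm _ hi]
    simp [fracConv]
  have h2 := hr.weak z _ _ (hu.memH1_potential t ht)
  rw [real_inner_comm (w t) (r z), real_inner_comm (w t) z] at h2
  rw [h1, real_inner_comm, hr.inner_lift, inner_smul_left, RCLike.conj_to_real,
    hu.evolution t ht _ _ (hr.memH1 z), real_inner_comm, ← h2]
  ring

theorem intervalIntegrable_error (hT : 0 < T) (hu : IsSolution bc Ω α γ ε T u gu w gw)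
    (hr : IsResolvent bc Ω m r q) :
    ∃ X, (∀ t ∈ Icc 0 T, ‖w t‖ ≤ X) ∧
      (∀ t ∈ Ioo 0 T, ‖m ^ 2 * inner ℝ (w t) (r (deriv u t))‖ ≤ X * ‖deriv u t‖) ∧
      IntervalIntegrable (fun t => m ^ 2 * inner ℝ (w t) (r (deriv u t))) volume 0 T := by
  obtain ⟨X, hX⟩ := isCompact_Icc.exists_bound_of_continuousOn hu.continuousOn_potential
  have hb : ∀ t ∈ Ioo 0 T, ‖m ^ 2 * inner ℝ (w t) (r (deriv u t))‖ ≤ X * ‖deriv u t‖ := by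
    intro t ht
    have h1 := hX t (Ioo_subset_Icc_self ht)
    have h2 := hr.sq_mul_norm_le (deriv u t)
    have h3 := norm_inner_le_norm (𝕜 := ℝ) (w t) (r (deriv u t))
    rw [norm_mul, Real.norm_of_nonneg (sq_nonneg m)]
    calc _ ≤ m ^ 2 * (‖w t‖ * ‖r (deriv u t)‖) := by gcongr
      _ = ‖w t‖ * (m ^ 2 * ‖r (deriv u t)‖) := by ring
      _ ≤ X * ‖deriv u t‖ := by
        gcongr
        exact (norm_nonneg _).trans h1
  refine ⟨X, hX, hb, ?_⟩
  rw [intervalIntegrable_iff_integrableOn_Ioo_of_le hT.le]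
  refine Integrable.mono' (hu.integrableOn_deriv.norm.const_mul X) ?_ ?_
  · refine ContinuousOn.aestronglyMeasurable ?_ measurableSet_Ioo
    exact (ContinuousOn.inner (𝕜 := ℝ) (hu.continuousOn_potential.mono Ioo_subset_Icc_self)
      (r.continuous.comp_continuousOn hu.continuousOn_deriv)).const_smul (m ^ 2)
  · filter_upwards [ae_restrict_mem measurableSet_Ioo] with t ht
    exact hb t ht

/-- Pairing the lifted increment with its fractional derivative gives at most a constant times
`‖u(t) - u(0)‖`, which tends to zero; a memory term staying above `η` near zero would force `η ≤ η /
2`. -/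
theorem frequently_memoryTerm_lt (hΩb : Bornology.IsBounded Ω) (hα0 : 0 < α) (hα1 : α < 1)
    (hγ : 0 < γ) (hT : 0 < T)
    (hu : IsSolution bc Ω α γ ε T u gu w gw)
    (hΨ : ∀ t ∈ Icc 0 T, IsPotential bc Ω (u t - u 0) (Ψ t) (gΨ t))
    (hD : ∀ t ∈ Ioc 0 T, NonlocalTermWellDefined α gΨ t) (hr : IsResolvent bc Ω m r q)
    {η : ℝ} (hη : 0 < η) :
    ∃ᶠ s in 𝓝[>] (0 : ℝ), memoryTerm α (fun t => resolventLift m r q (increment T u t)) s < η := by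
  have hpath := memoryPath_lift hΩb hα0 hα1 hT hu hΨ hD hr
  obtain ⟨X, hX, -, -⟩ := intervalIntegrable_error hT hu hr
  have hN : 0 < γ * Real.Gamma (1 - α) := mul_pos hγ (Real.Gamma_pos_of_pos (by linarith))
  set N := γ * Real.Gamma (1 - α)
  have hlim : Tendsto (fun t => N * (2 * X * ‖increment T u t‖)) (𝓝[>] 0) (𝓝 0) := by
    have hc := continuous_increment hT hu.continuousOn
    have : Continuous fun t => N * (2 * X * ‖increment T u t‖) := by fun_prop
    have h := (this.tendsto 0).mono_left (nhdsWithin_le_nhds (s := Ioi 0))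
    simpa [increment_eq u (left_mem_Icc.2 hT.le)] using h
  intro hcon
  have hev := (hcon.and (hlim.eventually_lt_const (half_pos hη))).and (Ioo_mem_nhdsGT hT)
  obtain ⟨b, hb, hsub⟩ := (mem_nhdsGT_iff_exists_Ioo_subset).1 hev
  have hb0 : (0 : ℝ) < min b (T / 2) := lt_min hb (by linarith)
  have hmem : ∀ s ∈ Ioo 0 (min b (T / 2)), s ∈ Ioo 0 b :=
    fun s hs => ⟨hs.1, hs.2.trans_le (min_le_left _ _)⟩
  have := hpath.le_of_forall_le_memoryTerm (η := η) (B := η / 2) hb0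
    ((min_le_right _ _).trans_lt (by linarith)) (fun s hs => ?_) (fun s hs => ?_)
  · linarith
  · exact not_lt.1 (hsub (hmem s hs)).1.1
  · have h1 := hsub (hmem s hs)
    have hsT : s ∈ Ioo 0 T := h1.2
    rw [inner_lift_fracConv hα0 hα1 hu hr hsT]
    refine le_trans ?_ h1.1.2.le
    set z := increment T u s
    have h2 := hX s (Ioo_subset_Icc_self hsT)
    have h3 := abs_le.1 (abs_real_inner_le_norm (w s) z)
    have h4 := abs_le.1 (abs_real_inner_le_norm (w s) (r z))
    have h5 := hr.sq_mul_norm_le z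
    have h6 : ‖w s‖ * ‖z‖ ≤ X * ‖z‖ := by gcongr
    have h7 : m ^ 2 * (‖w s‖ * ‖r z‖) ≤ X * ‖z‖ := by
      calc _ = ‖w s‖ * (m ^ 2 * ‖r z‖) := by ring
        _ ≤ ‖w s‖ * ‖z‖ := by gcongr
        _ ≤ X * ‖z‖ := h6
    have h8 := mul_le_mul_of_nonneg_left h4.2 (sq_nonneg m)
    rw [neg_mul, ← mul_neg]
    gcongr
    linarith [h3.1]

theorem memoryTerm_zero {K : Type*} [NormedAddCommGroup K] {y : ℝ → K} (hy : y 0 = 0) (β : ℝ) :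
    memoryTerm β y 0 = 0 := by
  simp [memoryTerm, hy]

/-- The energy inequality with the regularized `H⁻¹` norm and an error term. -/
theorem energy_add_memoryTerm_le (hΩb : Bornology.IsBounded Ω) (hα0 : 0 < α) (hα1 : α < 1)
    (hγ : 0 < γ) (hT : 0 < T)
    (hu : IsSolution bc Ω α γ ε T u gu w gw)
    (hΨ : ∀ t ∈ Icc 0 T, IsPotential bc Ω (u t - u 0) (Ψ t) (gΨ t))
    (hD : ∀ t ∈ Ioc 0 T, NonlocalTermWellDefined α gΨ t) (hr : IsResolvent bc Ω m r q)
    {s t : ℝ} (hs : 0 ≤ s) (hst : s ≤ t) (ht : t ≤ T) :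
    γ * Real.Gamma (1 - α) * energy Ω ε (u t) (gu t)
        + memoryTerm α (fun t => resolventLift m r q (increment T u t)) t ≤
      γ * Real.Gamma (1 - α) * energy Ω ε (u s) (gu s)
        + memoryTerm α (fun t => resolventLift m r q (increment T u t)) s
        + γ * Real.Gamma (1 - α) * ∫ τ in s..t, m ^ 2 * inner ℝ (w τ) (r (deriv u τ)) := by
  have hpath := memoryPath_lift hΩb hα0 hα1 hT hu hΨ hD hr
  have hfreq := fun (η : ℝ) (hη : 0 < η) =>
    frequently_memoryTerm_lt hΩb hα0 hα1 hγ hT hu hΨ hD hr (η := η) hη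
  have hconv := fun t (ht : t ∈ Ioo 0 T) z => inner_lift_fracConv hα0 hα1 hu hr ht z
  obtain ⟨X, hX, -, hρ⟩ := intervalIntegrable_error hT hu hr
  have hN : 0 < γ * Real.Gamma (1 - α) := mul_pos hγ (Real.Gamma_pos_of_pos (by linarith))
  set N := γ * Real.Gamma (1 - α)
  set ρ : ℝ → ℝ := fun τ => m ^ 2 * inner ℝ (w τ) (r (deriv u τ)) with hρdef
  set y : ℝ → WithLp 2 (L2 Ω × L2Vec Ω) := fun t => resolventLift m r q (increment T u t)
  set En : ℝ → ℝ := fun t => energy Ω ε (u t) (gu t)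
  have hsubint : ∀ {a b : ℝ}, a ∈ Icc 0 T → b ∈ Icc 0 T → IntervalIntegrable ρ volume a b := by
    intro a b ha hb
    refine hρ.mono_set ?_
    rw [uIcc_of_le hT.le]
    exact uIcc_subset_Icc ha hb
  have hPc : ContinuousOn (fun t => ∫ τ in (0 : ℝ)..t, ρ τ) (Icc 0 T) := by
    have := intervalIntegral.continuousOn_primitive_interval' hρ left_mem_uIcc
    rwa [uIcc_of_le hT.le] at this
  -- interior times
  have stepA : ∀ {s t : ℝ}, 0 < s → s ≤ t → t < T →
      N * En t + memoryTerm α y t ≤ N * En s + memoryTerm α y s + N * ∫ τ in s..t, ρ τ := by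
    intro s t hs hst ht
    have h1 := hpath.memoryTerm_sub_le hs hst ht
    have h2 := hu.energy_sub_eq_integral hΩb hs hst ht
    have hsub : ∀ τ ∈ uIcc s t, τ ∈ Ioo 0 T := fun τ hτ => by
      rw [uIcc_of_le hst] at hτ
      exact ⟨hs.trans_le hτ.1, hτ.2.trans_lt ht⟩
    have i1 : IntervalIntegrable (fun τ => inner ℝ (w τ) (deriv u τ)) volume s t :=
      (hu.continuousOn_inner_deriv.mono hsub).intervalIntegrable
    have i2 : IntervalIntegrable ρ volume s t :=
      hsubint ⟨hs.le, hst.trans ht.le⟩ ⟨hs.le.trans hst, ht.le⟩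
    have h3 : ∫ τ in s..t, inner ℝ (resolventLift m r q (deriv u τ))
        (fracConv α (fun t => resolventLift m r q (deriv u t)) τ)
        = -N * ((∫ τ in s..t, inner ℝ (w τ) (deriv u τ)) - ∫ τ in s..t, ρ τ) := by
      rw [← intervalIntegral.integral_sub i1 i2, ← intervalIntegral.integral_const_mul]
      exact intervalIntegral.integral_congr fun τ hτ => hconv τ (hsub τ hτ) _
    rw [h3, ← h2] at h1
    simp only [En]
    linarith
  -- initial time zero
  have stepB : ∀ {t : ℝ}, 0 < t → t < T →
      N * En t + memoryTerm α y t ≤ N * En 0 + N * ∫ τ in (0 : ℝ)..t, ρ τ := by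
    intro t ht0 ht
    refine le_of_forall_pos_le_add fun η hη => ?_
    obtain ⟨e, he, hle⟩ := hu.exists_energy_le_initial_add hΩb hT
    have hP0 : Tendsto (fun s => ∫ τ in (0 : ℝ)..s, ρ τ) (𝓝[>] 0) (𝓝 0) := by
      have h1 := hPc 0 (left_mem_Icc.2 hT.le)
      have h2 : 𝓝[>] (0 : ℝ) ≤ 𝓝[Icc 0 T] 0 := by
        rw [nhdsWithin_le_iff]
        exact mem_of_superset (Ioo_mem_nhdsGT hT) Ioo_subset_Icc_self
      simpa using h1.tendsto.mono_left h2
    have hlim : Tendsto (fun s => N * (En 0 + e s) + η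
        + N * ((∫ τ in (0 : ℝ)..t, ρ τ) - ∫ τ in (0 : ℝ)..s, ρ τ)) (𝓝[>] 0)
        (𝓝 (N * (En 0 + 0) + η + N * ((∫ τ in (0 : ℝ)..t, ρ τ) - 0))) :=
      (((he.const_add _).const_mul N).add_const η).add ((hP0.const_sub _).const_mul N)
    -- Smallness of the memory term is known only for arbitrarily small times, but a limit along
    -- those suffices as the right side converges.
    have := IsClosed.mem_of_frequently_of_tendsto (s := Ici (N * En t + memoryTerm α y t)) isClosed_Ici
      (((hfreq η hη).and_eventually (Ioo_mem_nhdsGT ht0)).mono fun s hs => ?_) hlim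
    · rw [mem_Ici] at this
      linarith
    · obtain ⟨hs1, hs2⟩ := hs
      have hsT : s ∈ Ioo 0 T := ⟨hs2.1, hs2.2.trans ht⟩
      have h1 := stepA hs2.1 hs2.2.le ht
      have h2 := mul_le_mul_of_nonneg_left (hle s hsT) hN.le
      have h3 := intervalIntegral.integral_add_adjacent_intervals
        (hsubint (left_mem_Icc.2 hT.le) (Ioo_subset_Icc_self hsT))
        (hsubint (Ioo_subset_Icc_self hsT) ⟨ht0.le, ht.le⟩)
      rw [mem_Ici, ← h3]
      simp only [En] at h1 ⊢
      have h4 : memoryTerm α y s < η := hs1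
      linarith
  have stepAB : ∀ {s t : ℝ}, 0 ≤ s → s < t → t < T →
      N * En t + memoryTerm α y t ≤ N * En s + memoryTerm α y s + N * ∫ τ in s..t, ρ τ := by
    intro s t hs hst ht
    rcases hs.eq_or_lt with rfl | hs
    · rw [memoryTerm_zero hpath.zero, add_zero]
      exact stepB hst ht
    · exact stepA hs hst.le ht
  rcases hst.eq_or_lt with rfl | hst
  · simp
  rcases ht.lt_or_eq with ht | rfl
  · exact stepAB hs hst ht
  -- final time
  obtain ⟨e, he, hle⟩ := hu.energy_le_add_of_tendsto hΩb (right_mem_Icc.2 hT.le)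
  have hT' : Ioo s t ∈ 𝓝[<] t := Ioo_mem_nhdsLT hst
  have hnh : 𝓝[<] t ≤ 𝓝[Icc 0 t] t := by
    rw [nhdsWithin_le_iff]
    exact mem_of_superset hT' fun x hx => ⟨hs.trans hx.1.le, hx.2.le⟩
  have hsI : s ∈ Icc 0 t := ⟨hs, hst.le⟩
  have h0I : (0 : ℝ) ∈ Icc 0 t := left_mem_Icc.2 hT.le
  -- The time limit is taken at fixed `δ`, where the memory term is continuous and lies below the
  -- singular one; only then does `δ → 0`.
  refine le_of_tendsto ((hpath.tendsto_shiftMemory (right_mem_Ioc.2 hT)).const_add (N * En t)) ?_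
  filter_upwards [self_mem_nhdsWithin] with δ hδ
  have hl1 : Tendsto (fun x => N * En t + shiftMemory α δ y x) (𝓝[<] t)
      (𝓝 (N * En t + shiftMemory α δ y t)) :=
    ((hpath.continuousAt_shiftMemory hδ hT.le).tendsto.mono_left nhdsWithin_le_nhds).const_add _
  have hl2 : Tendsto (fun x => N * En s + memoryTerm α y s
      + N * ((∫ τ in (0 : ℝ)..x, ρ τ) - ∫ τ in (0 : ℝ)..s, ρ τ) + N * e x) (𝓝[<] t)
      (𝓝 (N * En s + memoryTerm α y s
      + N * ((∫ τ in (0 : ℝ)..t, ρ τ) - ∫ τ in (0 : ℝ)..s, ρ τ) + N * 0)) :=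
    (((((hPc t (right_mem_Icc.2 hT.le)).tendsto.mono_left hnh).sub_const _).const_mul N).const_add
      _).add ((he.mono_left hnh).const_mul N)
  have hfin := le_of_tendsto_of_tendsto hl1 hl2 (by
    filter_upwards [hT'] with x hx
    have hxI : x ∈ Icc 0 t := ⟨hs.trans hx.1.le, hx.2.le⟩
    have h1 := stepAB hs hx.1 hx.2
    have h2 := mul_le_mul_of_nonneg_left (hle x hxI) hN.le
    have h3 := intervalIntegral.integral_add_adjacent_intervals (hsubint h0I hsI)
      (hsubint hsI hxI)
    have h4 := hpath.shiftMemory_le hδ (t := x) ⟨hs.trans_lt hx.1, hx.2.le⟩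
    rw [← h3]
    simp only [En] at h1 ⊢
    linarith)
  have h3 := intervalIntegral.integral_add_adjacent_intervals (hsubint h0I hsI)
    (hsubint hsI (right_mem_Icc.2 hT.le))
  rw [← h3] at hfin
  linarith

end FixedResolvent

end EnergyInequality

/-! ### Removing the resolvent regularization -/

section Limit

variable {d : ℕ} {Ω : Set (EuclideanSpace ℝ (Fin d))} {bc : BoundaryCondition d}
  {α γ ε T : ℝ} {u : ℝ → L2 Ω} {gu : ℝ → L2Vec Ω} {w : ℝ → L2 Ω} {gw : ℝ → L2Vec Ω}
  {Ψ : ℝ → L2 Ω} {gΨ : ℝ → L2Vec Ω}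
  {m : ℕ → ℝ} {r : ℕ → L2 Ω →L[ℝ] L2 Ω} {q : ℕ → L2 Ω →L[ℝ] L2Vec Ω}

theorem tendsto_norm_sq_lift (hm : Tendsto m atTop (𝓝 0))
    (hr : ∀ n, IsResolvent bc Ω (m n) (r n) (q n)) {x ψ : L2 Ω} {g : L2Vec Ω}
    (hψ : MemH1 bc Ω ψ g) (hg : ∀ φ Gφ, MemH1 bc Ω φ Gφ → inner ℝ g Gφ = inner ℝ x φ) :
    Tendsto (fun n => ‖resolventLift (m n) (r n) (q n) x‖ ^ 2) atTop (𝓝 (‖g‖ ^ 2)) := by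
  rw [tendsto_iff_dist_tendsto_zero]
  refine squeeze_zero (fun _ => dist_nonneg)
    (fun n => (hr n).abs_norm_sq_lift_sub_le hψ hg) ?_
  simpa using hm.mul_const (‖g‖ * ‖ψ‖)

/-- Dominated convergence with the integrand of `nonlocalTerm` as majorant, available because
`norm_lift_le` is uniform in `m`. -/
theorem tendsto_memoryTerm_lift (hΩb : Bornology.IsBounded Ω) (hα0 : 0 < α) (hα1 : α < 1)
    (hT : 0 < T) (hu : IsSolution bc Ω α γ ε T u gu w gw)
    (hΨ : ∀ t ∈ Icc 0 T, IsPotential bc Ω (u t - u 0) (Ψ t) (gΨ t))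
    (hD : ∀ t ∈ Ioc 0 T, NonlocalTermWellDefined α gΨ t) (hm : Tendsto m atTop (𝓝 0))
    (hr : ∀ n, IsResolvent bc Ω (m n) (r n) (q n)) {t : ℝ} (ht : t ∈ Icc 0 T) :
    Tendsto (fun n => memoryTerm α
      (fun t => resolventLift (m n) (r n) (q n) (increment T u t)) t) atTop
      (𝓝 (nonlocalTerm α gΨ t)) := by
  have h1 := tendsto_norm_sq_lift hm hr (hΨ t ht).1 (hΨ t ht).2.1
  have hle : ∀ n, ∀ τ ∈ Ioo 0 t,
      resolventLift (m n) (r n) (q n) (increment T u t)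
        - resolventLift (m n) (r n) (q n) (increment T u τ)
      = resolventLift (m n) (r n) (q n) (u t - u τ) := by
    intro n τ hτ
    rw [increment_eq u ht, increment_eq u ⟨hτ.1.le, hτ.2.le.trans ht.2⟩, ← map_sub,
      sub_sub_sub_cancel_right]
  refine Tendsto.add ?_ (Tendsto.const_mul _ ?_)
  · simp only [increment_eq u ht]
    exact h1.div_const _
  · rcases ht.1.eq_or_lt with rfl | ht0
    · simp
    refine tendsto_integral_of_dominated_convergence
      (fun τ => ‖gΨ t - gΨ τ‖ ^ 2 / (t - τ) ^ (α + 1)) (fun n => ?_) (hD t ⟨ht0, ht.2⟩)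
      (fun n => ?_) ?_
    · exact ((memoryPath_lift hΩb hα0 hα1 hT hu hΨ hD (hr n)).integrableOn_memory t
        ⟨ht0, ht.2⟩).aestronglyMeasurable
    · filter_upwards [ae_restrict_mem measurableSet_Ioo] with τ hτ
      have hp : 0 ≤ (t - τ) ^ (α + 1) := Real.rpow_nonneg (by linarith [hτ.2]) _
      rw [Real.norm_of_nonneg (div_nonneg (sq_nonneg _) hp), hle n τ hτ]
      gcongr
      exact (hr n).norm_lift_le (potential_sub hΩb hΨ ht ⟨hτ.1.le, hτ.2.le.trans ht.2⟩).2
    · filter_upwards [ae_restrict_mem measurableSet_Ioo] with τ hτ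
      simp only [hle _ τ hτ]
      have hp := potential_sub hΩb hΨ ht (τ := τ) ⟨hτ.1.le, hτ.2.le.trans ht.2⟩
      exact (tendsto_norm_sq_lift hm hr hp.1 hp.2).div_const _

/-- `m² (m² - Δ)⁻¹ ∂ₜu → 0` as `m → 0`, since `∂ₜu` is a limit of functions of the form `ΔΨ`. -/
theorem tendsto_sq_mul_norm_deriv (hΩb : Bornology.IsBounded Ω)
    (hu : IsSolution bc Ω α γ ε T u gu w gw)
    (hΨ : ∀ t ∈ Icc 0 T, IsPotential bc Ω (u t - u 0) (Ψ t) (gΨ t)) (hm : Tendsto m atTop (𝓝 0))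
    (hr : ∀ n, IsResolvent bc Ω (m n) (r n) (q n)) {t : ℝ} (ht : t ∈ Ioo 0 T) :
    Tendsto (fun n => m n ^ 2 * ‖r n (deriv u t)‖) atTop (𝓝 0) := by
  rw [Metric.tendsto_atTop']
  intro η hη
  have hsl := hasDerivAt_iff_tendsto_slope.1 (hu.differentiableAt t ht).hasDerivAt
  have hev := (Metric.tendsto_nhds.1 hsl (η / 2) (half_pos hη)).and
    (nhdsWithin_le_nhds (Ioo_mem_nhds ht.1 ht.2))
  -- A single difference quotient close to `∂ₜu` is fixed. The remainder is handled by the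
  -- contraction `m² ‖r x‖ ≤ ‖x‖`, the quotient by `m ‖r x‖ ≤ ‖g‖`, since it has a potential.
  obtain ⟨s, hs1, hs2⟩ := hev.exists
  have hp := potential_sub hΩb hΨ (Ioo_subset_Icc_self hs2) (Ioo_subset_Icc_self ht)
  have hlim : Tendsto (fun n => |(s - t)⁻¹| * (m n * ‖gΨ s - gΨ t‖)) atTop (𝓝 0) := by
    simpa using (hm.mul_const ‖gΨ s - gΨ t‖).const_mul |(s - t)⁻¹|
  obtain ⟨n₀, hn₀⟩ := eventually_atTop.1 (hlim.eventually_lt_const (half_pos hη))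
  refine ⟨n₀, fun n hn => ?_⟩
  have hpos := (hr n).pos
  have h1 := (hr n).sq_mul_norm_le (deriv u t - slope u t s)
  have h2 : m n ^ 2 * ‖r n (slope u t s)‖ ≤ |(s - t)⁻¹| * (m n * ‖gΨ s - gΨ t‖) := by
    rw [slope_def_module, map_smul, norm_smul, Real.norm_eq_abs]
    calc _ = |(s - t)⁻¹| * (m n * (m n * ‖r n (u s - u t)‖)) := by ring
      _ ≤ _ := by
        gcongr
        exact (hr n).mul_norm_le hp.2
  have h3 : ‖r n (deriv u t)‖ ≤ ‖r n (deriv u t - slope u t s)‖ + ‖r n (slope u t s)‖ := by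
    refine le_trans (le_of_eq ?_) (norm_add_le _ _)
    rw [← map_add, sub_add_cancel]
  have h4 := mul_le_mul_of_nonneg_left h3 (sq_nonneg (m n))
  have h5 := hn₀ n hn.le
  rw [dist_comm, dist_eq_norm] at hs1
  rw [Real.dist_eq, sub_zero, abs_of_nonneg (by positivity)]
  linarith

/-- The integrand is dominated by a multiple of `‖∂ₜu‖`, uniformly in `m`, and tends to zero at
every interior time. -/
theorem tendsto_integral_error (hΩb : Bornology.IsBounded Ω)
    (hT : 0 < T) (hu : IsSolution bc Ω α γ ε T u gu w gw)
    (hΨ : ∀ t ∈ Icc 0 T, IsPotential bc Ω (u t - u 0) (Ψ t) (gΨ t)) (hm : Tendsto m atTop (𝓝 0))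
    (hr : ∀ n, IsResolvent bc Ω (m n) (r n) (q n)) {s t : ℝ} (hs : 0 ≤ s) (hst : s ≤ t)
    (ht : t ≤ T) :
    Tendsto (fun n => ∫ τ in s..t, m n ^ 2 * inner ℝ (w τ) (r n (deriv u τ))) atTop (𝓝 0) := by
  obtain ⟨X, hX⟩ := isCompact_Icc.exists_bound_of_continuousOn hu.continuousOn_potential
  simp_rw [intervalIntegral.integral_of_le hst, integral_Ioc_eq_integral_Ioo]
  have hsub : Ioo s t ⊆ Ioo 0 T := Ioo_subset_Ioo hs ht
  have hb : ∀ n, ∀ τ ∈ Ioo 0 T, ‖m n ^ 2 * inner ℝ (w τ) (r n (deriv u τ))‖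
      ≤ X * (m n ^ 2 * ‖r n (deriv u τ)‖) := by
    intro n τ hτ
    rw [norm_mul, Real.norm_of_nonneg (sq_nonneg _)]
    calc _ ≤ m n ^ 2 * (‖w τ‖ * ‖r n (deriv u τ)‖) := by gcongr; exact norm_inner_le_norm _ _
      _ = ‖w τ‖ * (m n ^ 2 * ‖r n (deriv u τ)‖) := by ring
      _ ≤ _ := by gcongr; exact hX τ (Ioo_subset_Icc_self hτ)
  rw [← integral_zero ℝ ℝ (μ := volume.restrict (Ioo s t))]
  refine tendsto_integral_of_dominated_convergence (fun τ => X * ‖deriv u τ‖) (fun n => ?_)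
    ((hu.integrableOn_deriv.mono_set hsub).norm.const_mul X) (fun n => ?_) ?_
  · obtain ⟨-, -, -, h⟩ := intervalIntegrable_error hT hu (hr n)
    exact (((intervalIntegrable_iff_integrableOn_Ioo_of_le hT.le).1 h).mono_set
      hsub).aestronglyMeasurable
  · filter_upwards [ae_restrict_mem measurableSet_Ioo] with τ hτ
    refine (hb n τ (hsub hτ)).trans ?_
    have := (norm_nonneg _).trans (hX τ (Ioo_subset_Icc_self (hsub hτ)))
    gcongr
    exact (hr n).sq_mul_norm_le _
  · filter_upwards [ae_restrict_mem measurableSet_Ioo] with τ hτ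
    refine squeeze_zero_norm (fun n => hb n τ (hsub hτ)) ?_
    simpa using (tendsto_sq_mul_norm_deriv hΩb hu hΨ hm hr (hsub hτ)).const_mul X

theorem energy_add_nonlocalTerm_le (hΩb : Bornology.IsBounded Ω) (hα0 : 0 < α) (hα1 : α < 1)
    (hγ : 0 < γ) (hT : 0 < T) (hu : IsSolution bc Ω α γ ε T u gu w gw)
    (hΨ : ∀ t ∈ Icc 0 T, IsPotential bc Ω (u t - u 0) (Ψ t) (gΨ t))
    (hD : ∀ t ∈ Ioc 0 T, NonlocalTermWellDefined α gΨ t)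
    {s t : ℝ} (hs : 0 ≤ s) (hst : s ≤ t) (ht : t ≤ T) :
    γ * Real.Gamma (1 - α) * energy Ω ε (u t) (gu t) + nonlocalTerm α gΨ t ≤
      γ * Real.Gamma (1 - α) * energy Ω ε (u s) (gu s) + nonlocalTerm α gΨ s := by
  have hm : Tendsto (fun n : ℕ => 1 / ((n : ℝ) + 1)) atTop (𝓝 0) :=
    tendsto_one_div_add_atTop_nhds_zero_nat
  have hm0 : ∀ n : ℕ, 0 < 1 / ((n : ℝ) + 1) := fun n => by positivity
  choose r q hrq using fun n => exists_resolvent hΩb bc (hm0 n)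
  have hr : ∀ n : ℕ, IsResolvent bc Ω (1 / ((n : ℝ) + 1)) (r n) (q n) := fun n =>
    ⟨hm0 n, fun x => (hrq n x).1, fun x => (hrq n x).2⟩
  have h1 := (tendsto_memoryTerm_lift hΩb hα0 hα1 hT hu hΨ hD hm hr
    ⟨hs.trans hst, ht⟩).const_add (γ * Real.Gamma (1 - α) * energy Ω ε (u t) (gu t))
  have h2 := ((tendsto_memoryTerm_lift hΩb hα0 hα1 hT hu hΨ hD hm hr
    ⟨hs, hst.trans ht⟩).const_add (γ * Real.Gamma (1 - α) * energy Ω ε (u s) (gu s))).add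
    ((tendsto_integral_error hΩb hT hu hΨ hm hr hs hst ht).const_mul (γ * Real.Gamma (1 - α)))
  rw [mul_zero, add_zero] at h2
  exact le_of_tendsto_of_tendsto' h1 h2 fun n =>
    energy_add_memoryTerm_le hΩb hα0 hα1 hγ hT hu hΨ hD (hr n) hs hst ht

theorem nonlocalTerm_nonneg {β : ℝ} (hβ : 0 ≤ β) {g : ℝ → L2Vec Ω} {t : ℝ} (ht : 0 ≤ t) :
    0 ≤ nonlocalTerm β g t := by
  have h1 : 0 ≤ t ^ β := Real.rpow_nonneg ht _
  have h2 : 0 ≤ ∫ τ in Ioo 0 t, ‖g t - g τ‖ ^ 2 / (t - τ) ^ (β + 1) :=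
    setIntegral_nonneg measurableSet_Ioo fun τ hτ =>
      div_nonneg (sq_nonneg _) (Real.rpow_nonneg (by linarith [hτ.2]) _)
  rw [nonlocalTerm]
  positivity

theorem nonlocalTerm_zero {β : ℝ} (hβ : β ≠ 0) (g : ℝ → L2Vec Ω) : nonlocalTerm β g 0 = 0 := by
  -- At time zero the quotient is a division by `0 ^ β = 0`, which is zero by convention and agrees
  -- with the prescribed value.
  simp [nonlocalTerm, Real.zero_rpow hβ]

end Limit

end TFCH

end

/-! ### The energy estimates -/

theorem mainTheorem7 {d : ℕ} (Ω : Set (EuclideanSpace ℝ (Fin d))) (hΩo : IsOpen Ω)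
    (hΩb : Bornology.IsBounded Ω) (bc : TFCH.BoundaryCondition d) (hbc : bc.Admissible Ω)
    (α γ ε T : ℝ) (hα0 : 0 < α) (hα1 : α < 1) (hγ : 0 < γ) (hε : 0 < ε) (hT : 0 < T)
    (u : ℝ → TFCH.L2 Ω) (gu : ℝ → TFCH.L2Vec Ω) (w : ℝ → TFCH.L2 Ω) (gw : ℝ → TFCH.L2Vec Ω)
    (hu : TFCH.IsSolution bc Ω α γ ε T u gu w gw)
    (Ψ : ℝ → TFCH.L2 Ω) (gΨ : ℝ → TFCH.L2Vec Ω)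
    (hΨ : ∀ t ∈ Set.Icc 0 T, TFCH.IsPotential bc Ω (u t - u 0) (Ψ t) (gΨ t))
    (hD : ∀ t ∈ Set.Ioc 0 T, TFCH.NonlocalTermWellDefined α gΨ t ∧
      TFCH.NonlocalTermWellDefined (α + 1) gΨ t) :
    ∀ s t : ℝ, 0 ≤ s → s ≤ t → t ≤ T →
      TFCH.energy Ω ε (u t) (gu t) ≤ TFCH.modifiedEnergy α γ ε u gu gΨ t ∧
      TFCH.modifiedEnergy α γ ε u gu gΨ t ≤ TFCH.modifiedEnergy α γ ε u gu gΨ s ∧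
      TFCH.modifiedEnergy α γ ε u gu gΨ s ≤ TFCH.energy Ω ε (u 0) (gu 0) := by
  intro s t hs hst ht
  have hN : 0 < γ * Real.Gamma (1 - α) := mul_pos hγ (Real.Gamma_pos_of_pos (by linarith))
  have hmono : ∀ {s t : ℝ}, 0 ≤ s → s ≤ t → t ≤ T →
      TFCH.modifiedEnergy α γ ε u gu gΨ t ≤ TFCH.modifiedEnergy α γ ε u gu gΨ s := by
    intro s t hs hst ht
    have h := TFCH.energy_add_nonlocalTerm_le hΩb hα0 hα1 hγ hT hu hΨ (fun t ht => (hD t ht).1)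
      hs hst ht
    refine le_of_mul_le_mul_left ?_ hN
    rw [TFCH.modifiedEnergy, TFCH.modifiedEnergy, mul_add, mul_add, ← mul_assoc, ← mul_assoc,
      mul_one_div_cancel hN.ne', one_mul, one_mul]
    exact h
  refine ⟨?_, hmono hs hst ht, ?_⟩
  · have := TFCH.nonlocalTerm_nonneg (g := gΨ) hα0.le (hs.trans hst)
    rw [TFCH.modifiedEnergy]
    have h2 : 0 ≤ 1 / (γ * Real.Gamma (1 - α)) * TFCH.nonlocalTerm α gΨ t := by positivity
    linarith
  · refine (hmono le_rfl hs (hst.trans ht)).trans (le_of_eq ?_)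
    rw [TFCH.modifiedEnergy, TFCH.nonlocalTerm_zero hα0.ne', mul_zero, add_zero]
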